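/- Let $k$ be a field, let $H=\langle 9,19,20,25,31\rangle\subseteq\mathbb{N}$ be the numerical semigroup generated by $9,19,20,25,31$, and let $R=k[[H]]=k[[t^{9},t^{19},t^{20},t^{25},t^{31}]]\subseteq k[[t]]$ be its semigroup ring, i.e. the subring of all power series in which only powers $t^n$ with $n\in H$ occur. A finitely generated $R$-module $C$ is called semidualizing if the homothety map $R\to\operatorname{Hom}_R(C,C)$, $r\mapsto(c\mapsto rc)$, is an isomorphism and $\operatorname{Ext}^i_R(C,C)=0$ for all $i>0$. Then the local ring $R$ has only trivial semidualizing modules: $R$ has a canonical module, and if $K$ is a canonical module of $R$, then every semidualizing $R$-module $C$ satisfies $C\cong R$ or $C\cong K$. (Here a canonical module of a Cohen–Macaulay local ring $R$ of Krull dimension $d$ with residue field $\kappa$ is a finitely generated $R$-module $K$ with $\operatorname{Ext}^d_R(\kappa,K)\cong\kappa$ and $\operatorname{Ext}^i_R(\kappa,K)=0$ for all $i\neq d$; equivalently, a maximal Cohen–Macaulay module of type one and of finite injective dimension.) -/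

import Mathlib

open CategoryTheory PowerSeries

universe u

section SemigroupRings

/-- The semigroup ring `k⟦H⟧` of an additive submonoid `H ⊆ ℕ`: the subring of `k⟦t⟧` of all
formal power series in which only the powers `t ^ n` with `n ∈ H` occur. For
`H = ⟨a₁, …, a_l⟩` this is `k⟦t ^ a₁, …, t ^ a_l⟧`. -/
def semigroupRing (k : Type u) [Field k] (H : AddSubmonoid ℕ) : Subalgebra k k⟦X⟧ where
  carrier := {f | ∀ n : ℕ, coeff n f ≠ 0 → n ∈ H}
  mul_mem' := by
    intro f g hf hg n hn
    rw [PowerSeries.coeff_mul] at hn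
    obtain ⟨p, hp, hne⟩ := Finset.exists_ne_zero_of_sum_ne_zero hn
    rw [← Finset.HasAntidiagonal.mem_antidiagonal.mp hp]
    exact H.add_mem (hf _ (left_ne_zero_of_mul hne)) (hg _ (right_ne_zero_of_mul hne))
  add_mem' := by
    intro f g hf hg n hn
    by_cases h : coeff n f = 0
    · exact hg n (by simpa [h] using hn)
    · exact hf n h
  algebraMap_mem' := by
    intro r n hn
    have h0 : n = 0 := by
      by_contra h
      exact hn (by simp [PowerSeries.coeff_C, h])
    exact h0 ▸ H.zero_mem

/-- The inverse of a power series supported in `H` is supported in `H`. -/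
theorem inv_mem_semigroupRing {k : Type u} [Field k] {H : AddSubmonoid ℕ} {f : k⟦X⟧}
    (hf : f ∈ semigroupRing k H) : f⁻¹ ∈ semigroupRing k H := by
  intro n
  induction n using Nat.strong_induction_on with
  | _ n ih =>
    intro hn
    rw [PowerSeries.coeff_inv] at hn
    split_ifs at hn with h0
    · exact h0 ▸ H.zero_mem
    · obtain ⟨p, hp, hne⟩ := Finset.exists_ne_zero_of_sum_ne_zero (right_ne_zero_of_mul hn)
      split_ifs at hne with hlt
      · rw [← Finset.HasAntidiagonal.mem_antidiagonal.mp hp]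
        exact H.add_mem (hf _ (left_ne_zero_of_mul hne)) (ih _ hlt (right_ne_zero_of_mul hne))
      · exact absurd rfl hne

/-- The ring `k⟦H⟧` is local. -/
instance semigroupRing.isLocalRing (k : Type u) [Field k] (H : AddSubmonoid ℕ) :
    IsLocalRing (semigroupRing k H) := by
  have key : ∀ a : semigroupRing k H, constantCoeff (a : k⟦X⟧) ≠ 0 → IsUnit a := by
    intro a ha
    refine IsUnit.of_mul_eq_one ⟨(a : k⟦X⟧)⁻¹, inv_mem_semigroupRing a.2⟩ ?_
    exact Subtype.ext (PowerSeries.mul_inv_cancel _ ha)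
  refine IsLocalRing.of_isUnit_or_isUnit_one_sub_self fun a => ?_
  by_cases ha : constantCoeff (a : k⟦X⟧) = 0
  · exact Or.inr (key _ (by simp [ha]))
  · exact Or.inl (key _ ha)

end SemigroupRings

section SemidualizingModules

/-- A finitely generated `R`-module `C` is semidualizing if the homothety map
`R → Hom_R(C, C)`, `r ↦ (c ↦ r c)`, is bijective and `Ext^i_R(C, C) = 0` for all `i > 0`. -/
structure IsSemidualizing (R : Type u) [CommRing R] (C : Type u) [AddCommGroup C] [Module R C] :
    Prop where
  finite : Module.Finite R C
  homothety_bijective : Function.Bijective (LinearMap.lsmul R C)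
  ext_eq_zero : ∀ i : ℕ, 0 < i →
    Subsingleton (Abelian.Ext (ModuleCat.of R C) (ModuleCat.of R C) i)

/-- A canonical module of a (Cohen-Macaulay, Noetherian) local ring `R` with residue field `κ` and
Krull dimension `d`: a finitely generated `R`-module `K` with `Ext^d_R(κ, K) ≅ κ` and
`Ext^i_R(κ, K) = 0` for all `i ≠ d`, i.e. a maximal Cohen-Macaulay module of type one and of
finite injective dimension. -/
structure IsCanonicalModule (R : Type u) [CommRing R] [IsLocalRing R]
    (K : Type u) [AddCommGroup K] [Module R K] : Prop where
  finite : Module.Finite R K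
  ext_residueField_dim : ∀ i : ℕ, (i : WithBot ℕ∞) = ringKrullDim R →
    Nonempty (Abelian.Ext (ModuleCat.of R (IsLocalRing.ResidueField R)) (ModuleCat.of R K) i
      ≃ₗ[R] IsLocalRing.ResidueField R)
  ext_residueField_eq_zero : ∀ i : ℕ, (i : WithBot ℕ∞) ≠ ringKrullDim R →
    Subsingleton
      (Abelian.Ext (ModuleCat.of R (IsLocalRing.ResidueField R)) (ModuleCat.of R K) i)

/-- The local ring `R` has a canonical module and has only trivial semidualizing modules: every
semidualizing `R`-module is isomorphic to `R` or to the canonical module of `R`. -/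
def HasOnlyTrivialSemidualizingModules (R : Type u) [CommRing R] [IsLocalRing R] : Prop :=
  (∃ (K : Type u) (_ : AddCommGroup K) (_ : Module R K), IsCanonicalModule R K) ∧
  ∀ (K : Type u) [AddCommGroup K] [Module R K], IsCanonicalModule R K →
    ∀ (C : Type u) [AddCommGroup C] [Module R C], IsSemidualizing R C →
      Nonempty (C ≃ₗ[R] R) ∨ Nonempty (C ≃ₗ[R] K)

end SemidualizingModules

/-!
The modules over `R = k⟦H⟧` in question are realized as fractional ideals, that is as `R`-submodules
of `k⸨t⸩` of bounded order. With `F` the Frobenius number of `H`, the pairing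
`(x, y) ↦ coeff F (x * y)` on `k⸨t⸩` is perfect for the `t`-adic topology
(`exists_coeff_mul_eq`, `exists_coeff_mul_ne_zero`) and takes the role of Matlis duality. The
orthogonal `K` of `R` is the fractional ideal of all series supported in `{n | F - n ∉ H}`. It is a
canonical module, because `0 → K → k⸨t⸩ → k⸨t⸩ / K → 0` is an injective resolution
(`isCanonicalModule_canonicalFractionalIdeal`), and it is the only one: the condition on
`Ext¹(κ, M)` provides a functional on `(k⸨t⸩ ⊗ M) / M` that does not vanish on the socle, and this
functional embeds `M` into `k⸨t⸩` with image `K` (`nonempty_equiv_canonicalFractionalIdeal`).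

A semidualizing module is torsion-free of rank one, hence isomorphic to a fractional ideal `I` with
`1 ∈ I ⊆ k⟦t⟧`. The vanishing of `Ext¹(I, I)` says that every homomorphism `I → k⸨t⸩ / I` is a
multiplication (`IsSemidualizing.exists_equiv_isSemidualizingIdeal`); the higher `Ext` modules are
not needed. Let `I'` be the orthogonal of `I`, so that `I * I' ⊆ K`. The main point
(`IsSemidualizingIdeal.exists_coeff_mul_mul_ne_zero`) is that `x * y ∉ 𝔪K` for all
`x ∈ I \ 𝔪I` and `y ∈ I' \ 𝔪I'`: a functional on `I / 𝔪I` and one on `I' / 𝔪I'`, the latter given by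
a socle element of `k⸨t⸩ / I`, define a homomorphism `I → κ → k⸨t⸩ / I`, and the element `q` by which
it multiplies gives a functional `z ↦ coeff F (q * z)` on `K / 𝔪K`.

For `H = ⟨9, 19, 20, 25, 31⟩` the ideal `K` has the minimal generators `1, t, t ^ 7, t ^ 12`. If `I`
is generated by `1`, it is `R`; if `I'` is principal, then `I ≅ K`. Otherwise there are
`f ∈ I \ 𝔪I` and `g ∈ I' \ 𝔪I'` of positive order. The supports of `f * u`, for `u ∈ I'` of order
zero, and of `1 * g` restrict the orders of `f` and `g` to `1`, `7`, or at least `9`. As `K` has no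
elements of order `2`, `8` or `14`, one of the two, say `g`, has order at least `9`. Some combination
`x = a + b * f` with `(a, b) ≠ 0` satisfies `coeff 12 (x * g) = 0`. But the elements of `K` of order
at least `9` without a term `t ^ 12` lie in `𝔪K`, so that `x * g ∈ 𝔪K`, a contradiction
(`coeff_mul_eq_zero_of_coeff_twelve`). The other case is symmetric.
-/

open LaurentSeries HahnSeries IsLocalRing

/-! ### The filtration of `k⸨t⸩` by order and the residue pairing -/

section LaurentFiltration

variable {k : Type u} [Field k]

/-- The Laurent series of order at least `n`, that is `t ^ n k⟦t⟧`, as a subspace of `k⸨t⸩`. -/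
def laurentFil (k : Type u) [Field k] (n : ℤ) : Submodule k k⸨X⸩ where
  carrier := {x | ∀ i < n, x.coeff i = 0}
  add_mem' hx hy i hi := by simp [hx i hi, hy i hi]
  zero_mem' i _ := rfl
  smul_mem' c x hx i hi := by simp [hx i hi]

theorem laurentFil_anti {m n : ℤ} (h : m ≤ n) : laurentFil k n ≤ laurentFil k m :=
  fun _ hx i hi => hx i (hi.trans_le h)

theorem mem_laurentFil_order (x : k⸨X⸩) : x ∈ laurentFil k x.order :=
  fun _ hi => coeff_eq_zero_of_lt_order hi

theorem mem_laurentFil_succ {n : ℤ} {x : k⸨X⸩} (hx : x ∈ laurentFil k n) (h : x.coeff n = 0) :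
    x ∈ laurentFil k (n + 1) := by
  intro i hi
  rcases (Int.lt_add_one_iff.mp hi).lt_or_eq with h' | rfl
  · exact hx i h'
  · exact h

theorem single_mem_laurentFil (n : ℤ) (a : k) : (single n a : k⸨X⸩) ∈ laurentFil k n :=
  fun _ hi => coeff_single_of_ne hi.ne

theorem mul_mem_laurentFil {m n : ℤ} {x y : k⸨X⸩} (hx : x ∈ laurentFil k m)
    (hy : y ∈ laurentFil k n) : x * y ∈ laurentFil k (m + n) := by
  intro i hi
  rw [HahnSeries.coeff_mul]
  refine Finset.sum_eq_zero fun p hp => ?_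
  obtain ⟨h1, h2, h3⟩ := Finset.mem_antidiagonal.mp hp
  by_contra h
  have ha : m ≤ p.1 := not_lt.mp fun h' => h1 (hx _ h')
  have hb : n ≤ p.2 := not_lt.mp fun h' => h2 (hy _ h')
  omega

theorem coeff_mul_of_mem_laurentFil {m n : ℤ} {x y : k⸨X⸩} (hx : x ∈ laurentFil k m)
    (hy : y ∈ laurentFil k n) : (x * y).coeff (m + n) = x.coeff m * y.coeff n := by
  have hx' : x - single m (x.coeff m) ∈ laurentFil k (m + 1) := by
    refine mem_laurentFil_succ (Submodule.sub_mem _ hx (single_mem_laurentFil _ _)) ?_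
    simp
  have h := mul_mem_laurentFil hx' hy (m + n) (by omega)
  rw [sub_mul, coeff_sub, sub_eq_zero] at h
  rw [h, add_comm m n, coeff_single_mul_add]

theorem coeff_single_mul' (a n : ℤ) (c : k) (x : k⸨X⸩) :
    (single a c * x).coeff n = c * x.coeff (n - a) := by
  conv_lhs => rw [show n = (n - a) + a by ring]
  exact coeff_single_mul_add

theorem inv_mem_laurentFil {x : k⸨X⸩} {n : ℤ} (hx : x ∈ laurentFil k n) (h : x.coeff n ≠ 0) :
    x⁻¹ ∈ laurentFil k (-n) := by
  have hx0 : x ≠ 0 := by rintro rfl; simp at h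
  have h1 := coeff_mul_of_mem_laurentFil hx (mem_laurentFil_order x⁻¹)
  rw [mul_inv_cancel₀ hx0, HahnSeries.coeff_one] at h1
  have h2 : (x⁻¹).coeff (x⁻¹).order ≠ 0 := coeff_order_eq_zero.not.mpr (inv_ne_zero hx0)
  have h3 : n + (x⁻¹).order = 0 := by
    by_contra hne
    rw [if_neg hne] at h1
    exact mul_ne_zero h h2 h1.symm
  exact laurentFil_anti (by omega) (mem_laurentFil_order x⁻¹)

/-- Laurent series are approximated, modulo any power of `t`, by Laurent polynomials. -/
theorem sub_sum_single_mem_laurentFil {a : ℤ} {x : k⸨X⸩} (hx : x ∈ laurentFil k a) (b : ℤ) :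
    x - ∑ i ∈ Finset.Ico a b, single i (x.coeff i) ∈ laurentFil k b := by
  intro n hn
  rw [coeff_sub, coeff_sum, sub_eq_zero]
  by_cases h : a ≤ n
  · rw [Finset.sum_eq_single n]
    · simp
    · intro i _ hi
      exact coeff_single_of_ne hi.symm
    · intro h'
      exact absurd (Finset.mem_Ico.mpr ⟨h, hn⟩) h'
  · rw [hx n (not_le.mp h), Finset.sum_eq_zero]
    intro i hi
    have := (Finset.mem_Ico.mp hi).1
    exact coeff_single_of_ne (by omega)

theorem single_eq_smul (i : ℤ) (c : k) : (single i c : k⸨X⸩) = c • (single i 1 : k⸨X⸩) := by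
  rw [← HahnSeries.single_zero_mul_eq_smul, HahnSeries.single_mul_single, zero_add, mul_one]

/-- A linear functional on `k⸨t⸩` that vanishes on a power of `t` is determined by its values on
the monomials. -/
theorem linearMap_ext_of_laurentFil {p q : k⸨X⸩ →ₗ[k] k} {N : ℤ}
    (hp : ∀ x ∈ laurentFil k N, p x = 0) (hq : ∀ x ∈ laurentFil k N, q x = 0)
    (h : ∀ n : ℤ, p (single n 1) = q (single n 1)) : p = q := by
  ext x
  have hx := sub_sum_single_mem_laurentFil (mem_laurentFil_order x) N
  have h1 := hp _ hx
  have h2 := hq _ hx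
  rw [map_sub, sub_eq_zero] at h1 h2
  rw [h1, h2, map_sum, map_sum]
  refine Finset.sum_congr rfl fun i _ => ?_
  rw [single_eq_smul, map_smul, map_smul, h]

/-- The coefficient of `t ^ n`, as a linear functional on `k⸨t⸩`. -/
def laurentCoeff (k : Type u) [Field k] (n : ℤ) : k⸨X⸩ →ₗ[k] k where
  toFun x := x.coeff n
  map_add' _ _ := rfl
  map_smul' _ _ := rfl

/-- The functional `x ↦ coeff F (y * x)` on `k⸨t⸩`. -/
noncomputable def laurentPairing (F : ℤ) (y : k⸨X⸩) : k⸨X⸩ →ₗ[k] k where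
  toFun x := (y * x).coeff F
  map_add' u v := by rw [mul_add, coeff_add]
  map_smul' c x := by
    rw [← HahnSeries.C_mul_eq_smul, mul_left_comm, HahnSeries.C_mul_eq_smul, HahnSeries.coeff_smul,
      RingHom.id_apply]

theorem coeff_mul_eq_zero_of_mem_laurentFil {F : ℤ} (y : k⸨X⸩) {x : k⸨X⸩}
    (hx : x ∈ laurentFil k (F + 1 - y.order)) : (y * x).coeff F = 0 :=
  mul_mem_laurentFil (mem_laurentFil_order y) hx _ (by omega)

/-- A functional on `k⸨t⸩` that vanishes on a power of `t` has the form `x ↦ coeff F (y * x)`. -/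
theorem exists_coeff_mul_eq (F : ℤ) {p : k⸨X⸩ →ₗ[k] k} {N : ℤ}
    (hp : ∀ x ∈ laurentFil k N, p x = 0) :
    ∃ y : k⸨X⸩, ∀ x, p x = (y * x).coeff F := by
  let y : k⸨X⸩ := HahnSeries.ofSuppBddBelow (fun n => p (single (F - n) 1)) ⟨F - N, fun n hn => by
    by_contra h
    exact hn (hp _ (laurentFil_anti (by omega) (single_mem_laurentFil _ _)))⟩
  have hq : ∀ x ∈ laurentFil k (max N (F + 1 - y.order)),
      laurentPairing F y x = 0 := fun x hx =>
    coeff_mul_eq_zero_of_mem_laurentFil y (laurentFil_anti (le_max_right _ _) hx)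
  refine ⟨y, LinearMap.congr_fun (linearMap_ext_of_laurentFil
    (fun x hx => hp x (laurentFil_anti (le_max_left _ _) hx)) hq fun n => ?_)⟩
  change p (single n 1) = (y * single n 1).coeff F
  rw [mul_comm, coeff_single_mul', one_mul]
  change _ = p (single (F - (F - n)) 1)
  rw [sub_sub_cancel]

theorem eq_of_forall_coeff_mul_eq {F : ℤ} {y z : k⸨X⸩}
    (h : ∀ x, (y * x).coeff F = (z * x).coeff F) : y = z := by
  ext n
  have := h (single (F - n) 1)
  rwa [mul_comm, mul_comm z, coeff_single_mul', coeff_single_mul', one_mul, one_mul,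
    sub_sub_cancel] at this

/-- The pairing `(x, y) ↦ coeff F (x * y)` is perfect: a subspace that contains a power of `t`
is its own double orthogonal. -/
theorem exists_coeff_mul_ne_zero (F : ℤ) {W : Submodule k k⸨X⸩} {N : ℤ}
    (hN : laurentFil k N ≤ W) {x : k⸨X⸩} (hxW : x ∉ W) :
    ∃ s : k⸨X⸩, (∀ w ∈ W, (s * w).coeff F = 0) ∧ (s * x).coeff F ≠ 0 := by
  obtain ⟨p, hp, hpW⟩ := Submodule.exists_le_ker_of_notMem hxW
  obtain ⟨s, hs⟩ := exists_coeff_mul_eq F (p := p) (N := N) fun y hy => hpW (hN hy)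
  refine ⟨s, fun w hw => ?_, ?_⟩
  · rw [← hs w]; exact hpW hw
  · rw [← hs x]; exact hp

end LaurentFiltration

/-! ### The semigroup ring as a subring of `k⸨t⸩` -/

section SemigroupRingInLaurent

variable {k : Type u} [Field k] {H : AddSubmonoid ℕ}

-- Shortcuts: the generic searches for these instances are slow.
noncomputable instance : Module (semigroupRing k H) k⸨X⸩ := Algebra.toModule

noncomputable instance : SMul (semigroupRing k H) k⸨X⸩ := Algebra.toSMul

noncomputable instance {I : Submodule (semigroupRing k H) k⸨X⸩} : SMul (semigroupRing k H) I :=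
  Submodule.smul I

noncomputable instance {I : Submodule (semigroupRing k H) k⸨X⸩} :
    SMul (semigroupRing k H) (k⸨X⸩ ⧸ I) :=
  Submodule.Quotient.instSMul I

theorem semigroupRing_smul_def (r : semigroupRing k H) (x : k⸨X⸩) :
    r • x = algebraMap (semigroupRing k H) k⸨X⸩ r * x :=
  Algebra.smul_def r x

theorem algebraMap_semigroupRing_eq (r : semigroupRing k H) :
    algebraMap (semigroupRing k H) k⸨X⸩ r = ((r : k⟦X⟧) : k⸨X⸩) := rfl

theorem algebraMap_algebraMap_semigroupRing (c : k) :
    algebraMap (semigroupRing k H) k⸨X⸩ (algebraMap k _ c) = HahnSeries.C c := by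
  rw [algebraMap_semigroupRing_eq]
  exact PowerSeries.coe_C c

instance : IsScalarTower k (semigroupRing k H) k⸨X⸩ where
  smul_assoc c r x := by
    rw [semigroupRing_smul_def, semigroupRing_smul_def, Algebra.smul_def, map_mul,
      algebraMap_algebraMap_semigroupRing, mul_assoc, HahnSeries.C_mul_eq_smul]

instance : FaithfulSMul (semigroupRing k H) k⸨X⸩ :=
  (faithfulSMul_iff_algebraMap_injective _ _).mpr fun _ _ h =>
    Subtype.ext (HahnSeries.ofPowerSeries_injective h)

theorem coeff_algebraMap_natCast (r : semigroupRing k H) (n : ℕ) :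
    (algebraMap (semigroupRing k H) k⸨X⸩ r).coeff n = PowerSeries.coeff n (r : k⟦X⟧) :=
  LaurentSeries.coeff_coe_powerSeries _ _

/-- A Laurent series lies in `k⟦H⟧` iff it is supported in `H`. -/
theorem mem_range_algebraMap_iff {x : k⸨X⸩} :
    x ∈ (algebraMap (semigroupRing k H) k⸨X⸩).range ↔
      ∀ n : ℤ, x.coeff n ≠ 0 → ∃ h ∈ H, (h : ℤ) = n := by
  constructor
  · rintro ⟨r, rfl⟩ n hn
    rw [algebraMap_semigroupRing_eq, PowerSeries.coeff_coe] at hn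
    split_ifs at hn with h
    · exact absurd rfl hn
    · exact ⟨n.natAbs, r.2 _ hn, by omega⟩
  · intro hx
    refine ⟨⟨PowerSeries.mk fun n => x.coeff n, fun n hn => ?_⟩, ?_⟩
    · rw [PowerSeries.coeff_mk] at hn
      obtain ⟨h, hh, e⟩ := hx _ hn
      rwa [← Nat.cast_injective e]
    · ext n
      rw [algebraMap_semigroupRing_eq, PowerSeries.coeff_coe]
      split_ifs with h
      · by_contra hne
        obtain ⟨j, -, rfl⟩ := hx n (Ne.symm hne)
        omega
      · rw [PowerSeries.coeff_mk, Int.natCast_natAbs, abs_of_nonneg (not_lt.mp h)]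

theorem algebraMap_mem_laurentFil (r : semigroupRing k H) :
    algebraMap (semigroupRing k H) k⸨X⸩ r ∈ laurentFil k 0 := by
  intro i hi
  by_contra h
  obtain ⟨j, -, rfl⟩ := mem_range_algebraMap_iff.mp ⟨r, rfl⟩ _ h
  omega

theorem mem_maximalIdeal_semigroupRing {r : semigroupRing k H} :
    r ∈ maximalIdeal (semigroupRing k H) ↔
      (algebraMap (semigroupRing k H) k⸨X⸩ r).coeff 0 = 0 := by
  rw [mem_maximalIdeal, mem_nonunits_iff, not_iff_comm, ← ne_eq]
  constructor
  · intro h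
    have h0 : constantCoeff (r : k⟦X⟧) ≠ 0 := by
      rw [← Nat.cast_zero, coeff_algebraMap_natCast] at h
      simpa using h
    exact IsUnit.of_mul_eq_one ⟨(r : k⟦X⟧)⁻¹, inv_mem_semigroupRing r.2⟩
      (Subtype.ext (PowerSeries.mul_inv_cancel _ h0))
  · rintro ⟨u, rfl⟩ h
    have h1 := coeff_mul_of_mem_laurentFil
      (algebraMap_mem_laurentFil (u : semigroupRing k H))
      (algebraMap_mem_laurentFil ((u⁻¹ : (semigroupRing k H)ˣ) : semigroupRing k H))
    rw [← map_mul, Units.mul_inv, map_one, h, zero_mul] at h1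
    simp [HahnSeries.coeff_one] at h1

theorem algebraMap_mem_laurentFil_one {r : semigroupRing k H}
    (hr : r ∈ maximalIdeal (semigroupRing k H)) :
    algebraMap (semigroupRing k H) k⸨X⸩ r ∈ laurentFil k 1 :=
  mem_laurentFil_succ (algebraMap_mem_laurentFil r) (mem_maximalIdeal_semigroupRing.mp hr)

theorem exists_sub_mem_maximalIdeal (r : semigroupRing k H) :
    ∃ c : k, r - algebraMap k _ c ∈ maximalIdeal (semigroupRing k H) := by
  refine ⟨(algebraMap (semigroupRing k H) k⸨X⸩ r).coeff 0, ?_⟩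
  rw [mem_maximalIdeal_semigroupRing, map_sub, algebraMap_algebraMap_semigroupRing, coeff_sub,
    HahnSeries.C_apply, coeff_single_same, sub_self]

theorem exists_algebraMap_eq_single {h : ℕ} (hh : h ∈ H) :
    ∃ r : semigroupRing k H, algebraMap (semigroupRing k H) k⸨X⸩ r = single (h : ℤ) 1 := by
  refine mem_range_algebraMap_iff.mpr fun n hn => ⟨h, hh, ?_⟩
  by_contra hne
  exact hn (coeff_single_of_ne (Ne.symm hne))

theorem exists_mem_maximalIdeal_eq_single {h : ℕ} (hh : h ∈ H) (h0 : h ≠ 0) :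
    ∃ r ∈ maximalIdeal (semigroupRing k H),
      algebraMap (semigroupRing k H) k⸨X⸩ r = single (h : ℤ) 1 := by
  obtain ⟨r, hr⟩ := exists_algebraMap_eq_single (k := k) hh
  refine ⟨r, mem_maximalIdeal_semigroupRing.mpr ?_, hr⟩
  rw [hr]
  exact coeff_single_of_ne (by exact_mod_cast h0.symm)

/-- The power series of order above the Frobenius number `F` form the conductor of `k⟦H⟧`. -/
theorem exists_algebraMap_eq_of_mem_laurentFil {F : ℕ} (hF : ∀ n, F < n → n ∈ H) {x : k⸨X⸩}
    (hx : x ∈ laurentFil k (F + 1)) :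
    ∃ r : semigroupRing k H, algebraMap (semigroupRing k H) k⸨X⸩ r = x := by
  refine mem_range_algebraMap_iff.mpr fun n hn => ?_
  have h1 : (F : ℤ) + 1 ≤ n := not_lt.mp fun h => hn (hx _ h)
  exact ⟨n.toNat, hF _ (by omega), by omega⟩

theorem exists_mem_maximalIdeal_eq_of_mem_laurentFil {F : ℕ} (hF : ∀ n, F < n → n ∈ H) {x : k⸨X⸩}
    (hx : x ∈ laurentFil k (F + 1)) :
    ∃ r ∈ maximalIdeal (semigroupRing k H), algebraMap (semigroupRing k H) k⸨X⸩ r = x := by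
  obtain ⟨r, hr⟩ := exists_algebraMap_eq_of_mem_laurentFil hF hx
  refine ⟨r, mem_maximalIdeal_semigroupRing.mpr ?_, hr⟩
  rw [hr]
  exact hx 0 (by omega)

theorem algebraMap_semigroupRing_injective :
    Function.Injective (algebraMap (semigroupRing k H) k⸨X⸩) :=
  FaithfulSMul.algebraMap_injective _ _

theorem isFractionRing_laurentSeries {F : ℕ} (hF : ∀ n, F < n → n ∈ H) :
    IsFractionRing (semigroupRing k H) k⸨X⸩ := by
  refine IsFractionRing.of_field _ _ fun z => ?_
  obtain ⟨r, hr⟩ := exists_algebraMap_eq_of_mem_laurentFil hF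
    (single_mem_laurentFil (k := k) (F + 1 + z.order.natAbs) 1 |> laurentFil_anti (by omega))
  obtain ⟨r', hr'⟩ := exists_algebraMap_eq_of_mem_laurentFil (k := k) hF
    (x := single ((F : ℤ) + 1 + z.order.natAbs) 1 * z) (laurentFil_anti (by omega)
      (mul_mem_laurentFil (single_mem_laurentFil _ _) (mem_laurentFil_order z)))
  refine ⟨r', r, ?_⟩
  rw [hr, hr', mul_comm, mul_div_cancel_right₀]
  exact single_ne_zero one_ne_zero

/-- Every nonzero ideal of `k⟦H⟧` contains all power series of large order. -/
theorem exists_laurentFil_dvd {F : ℕ} (hF : ∀ n, F < n → n ∈ H) {r : semigroupRing k H}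
    (hr : r ≠ 0) : ∃ N : ℤ, ∀ x : semigroupRing k H,
      algebraMap (semigroupRing k H) k⸨X⸩ x ∈ laurentFil k N → r ∣ x := by
  set y := algebraMap (semigroupRing k H) k⸨X⸩ r with hy
  have hy0 : y ≠ 0 := by
    simpa [hy] using (map_ne_zero_iff _ algebraMap_semigroupRing_injective).mpr hr
  refine ⟨F + 1 - (y⁻¹).order, fun x hx => ?_⟩
  have h := mul_mem_laurentFil hx (mem_laurentFil_order y⁻¹)
  rw [sub_add_cancel] at h
  obtain ⟨s, hs⟩ := exists_algebraMap_eq_of_mem_laurentFil hF h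
  refine ⟨s, algebraMap_semigroupRing_injective ?_⟩
  rw [map_mul, hs, ← hy, mul_left_comm, mul_inv_cancel₀ hy0, mul_one]

theorem maximalIdeal_semigroupRing_ne_bot {F : ℕ} (hF : ∀ n, F < n → n ∈ H) :
    maximalIdeal (semigroupRing k H) ≠ ⊥ := by
  obtain ⟨r, hr, hr'⟩ := exists_mem_maximalIdeal_eq_single (k := k) (hF (F + 1) (by omega))
    (by omega)
  intro h
  rw [h, Ideal.mem_bot] at hr
  rw [hr, map_zero] at hr'
  exact single_ne_zero one_ne_zero hr'.symm

theorem ringKrullDim_semigroupRing {F : ℕ} (hF : ∀ n, F < n → n ∈ H) :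
    ringKrullDim (semigroupRing k H) = 1 := by
  refine ringKrullDim_eq_one_iff_of_isLocalRing_isDomain.mpr ⟨fun h =>
    maximalIdeal_semigroupRing_ne_bot (k := k) hF
      ((IsLocalRing.isField_iff_maximalIdeal_eq).mp h), fun r hr0 x hx => ?_⟩
  obtain ⟨N, hN⟩ := exists_laurentFil_dvd hF hr0
  have hpow : ∀ n : ℕ, algebraMap (semigroupRing k H) k⸨X⸩ (x ^ n) ∈ laurentFil k n := by
    intro n
    induction n with
    | zero => exact algebraMap_mem_laurentFil _
    | succ n ih =>
      rw [pow_succ, map_mul, Nat.cast_succ]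
      exact mul_mem_laurentFil ih (algebraMap_mem_laurentFil_one hx)
  exact ⟨N.toNat, Ideal.mem_span_singleton.mpr
    (hN _ (laurentFil_anti (Int.self_le_toNat N) (hpow _)))⟩

end SemigroupRingInLaurent

/-! ### Socle elements -/

section SocleElements

variable {k : Type u} [Field k] {H : AddSubmonoid ℕ}

/-- In a `k⟦H⟧`-module, a nonzero torsion element has a nonzero multiple that is killed by the
maximal ideal. -/
theorem exists_smul_ne_zero_of_torsion {F : ℕ} (hF : ∀ n, F < n → n ∈ H) {N : Type*}
    [AddCommGroup N] [Module (semigroupRing k H) N] {c : N} (hc : c ≠ 0) {r : semigroupRing k H}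
    (hr : r ≠ 0) (hrc : r • c = 0) :
    ∃ s : semigroupRing k H, s • c ≠ 0 ∧
      ∀ a ∈ maximalIdeal (semigroupRing k H), a • s • c = 0 := by
  by_contra! hcon
  obtain ⟨N₀, hN⟩ := exists_laurentFil_dvd hF hr
  -- The elements of order at least `j` kill `c`, by descending induction on `j`.
  have key : ∀ n : ℕ, ∀ s : semigroupRing k H,
      algebraMap (semigroupRing k H) k⸨X⸩ s ∈ laurentFil k (N₀ - n) → s • c = 0 := by
    intro n
    induction n with
    | zero =>
      intro s hs
      obtain ⟨d, rfl⟩ := hN s (laurentFil_anti (by simp) hs)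
      rw [mul_comm, mul_smul, hrc, smul_zero]
    | succ n ih =>
      intro s hs
      by_contra h
      obtain ⟨a, ha, ha'⟩ := hcon s h
      refine ha' ?_
      rw [smul_smul]
      refine ih _ ?_
      rw [map_mul]
      exact laurentFil_anti (by push_cast; omega)
        (mul_mem_laurentFil (algebraMap_mem_laurentFil_one ha) hs)
  refine hc ?_
  rw [← one_smul (semigroupRing k H) c]
  refine key N₀.toNat 1 ?_
  exact laurentFil_anti (by omega) (algebraMap_mem_laurentFil _)

/-- A linear functional on `M / 𝔪M` and an element of `N` killed by `𝔪` define a homomorphism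
`M → k → N` of `k⟦H⟧`-modules. -/
theorem exists_linearMap_apply_eq_smul {M N : Type*} [AddCommGroup M] [AddCommGroup N]
    [Module (semigroupRing k H) M] [Module (semigroupRing k H) N] [Module k M] [Module k N]
    [IsScalarTower k (semigroupRing k H) M] [IsScalarTower k (semigroupRing k H) N]
    (p : M →ₗ[k] k) (hp : ∀ a ∈ maximalIdeal (semigroupRing k H), ∀ x, p (a • x) = 0) {s : N}
    (hs : ∀ a ∈ maximalIdeal (semigroupRing k H), a • s = 0) :
    ∃ f : M →ₗ[semigroupRing k H] N, ∀ x, f x = p x • s := by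
  refine ⟨{ toFun := fun x => p x • s
            map_add' := fun x y => by rw [map_add, add_smul]
            map_smul' := fun r x => ?_ }, fun _ => rfl⟩
  obtain ⟨c, hc⟩ := exists_sub_mem_maximalIdeal r
  obtain ⟨a, ha, rfl⟩ : ∃ a ∈ maximalIdeal (semigroupRing k H), r = a + algebraMap k _ c :=
    ⟨_, hc, by ring⟩
  have h0 : a • p x • s = 0 := by
    rw [← algebraMap_smul (semigroupRing k H) (p x) s, smul_comm, hs a ha, smul_zero]
  rw [RingHom.id_apply, add_smul, add_smul, map_add, hp a ha, zero_add, h0, zero_add,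
    algebraMap_smul, algebraMap_smul, map_smul, smul_assoc]

end SocleElements

/-! ### The canonical fractional ideal and its injective resolution -/

section CanonicalModule

variable {k : Type u} [Field k] {H : AddSubmonoid ℕ}

/-- For a numerical semigroup `H` with Frobenius number `F`, the fractional ideal of `k⟦H⟧` of all
Laurent series supported in `{n | F - n ∉ H}`. It is the orthogonal of `k⟦H⟧` under the pairing
`(x, y) ↦ coeff F (x * y)`. -/
def canonicalFractionalIdeal (k : Type u) [Field k] (H : AddSubmonoid ℕ) (F : ℕ) :
    Submodule (semigroupRing k H) k⸨X⸩ where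
  carrier := {x | ∀ h ∈ H, x.coeff ((F : ℤ) - h) = 0}
  add_mem' hx hy h hh := by simp [hx h hh, hy h hh]
  zero_mem' _ _ := rfl
  smul_mem' r x hx h hh := by
    rw [semigroupRing_smul_def, HahnSeries.coeff_mul]
    refine Finset.sum_eq_zero fun p hp => ?_
    obtain ⟨h1, h2, h3⟩ := Finset.mem_antidiagonal.mp hp
    obtain ⟨j, hj, e⟩ := mem_range_algebraMap_iff.mp ⟨r, rfl⟩ _ h1
    have := hx (h + j) (H.add_mem hh hj)
    rw [show (p.2 : ℤ) = (F : ℤ) - ((h + j : ℕ) : ℤ) by push_cast; linarith, this, mul_zero]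

theorem mem_canonicalFractionalIdeal {F : ℕ} {x : k⸨X⸩} :
    x ∈ canonicalFractionalIdeal k H F ↔ ∀ h ∈ H, x.coeff ((F : ℤ) - h) = 0 :=
  Iff.rfl

theorem mem_canonicalFractionalIdeal_iff_forall_smul {F : ℕ} {x : k⸨X⸩} :
    x ∈ canonicalFractionalIdeal k H F ↔ ∀ r : semigroupRing k H, (r • x).coeff (F : ℤ) = 0 := by
  constructor
  · intro hx r
    simpa using (canonicalFractionalIdeal k H F).smul_mem r hx 0 H.zero_mem
  · intro hx h hh
    obtain ⟨r, hr⟩ := exists_algebraMap_eq_single (k := k) hh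
    have := hx r
    rwa [semigroupRing_smul_def, hr, coeff_single_mul', one_mul] at this

theorem canonicalFractionalIdeal_le_laurentFil {F : ℕ} (hF : ∀ n, F < n → n ∈ H) {x : k⸨X⸩}
    (hx : x ∈ canonicalFractionalIdeal k H F) : x ∈ laurentFil k 0 := by
  intro i hi
  have := hx ((F : ℤ) - i).toNat (hF _ (by omega))
  rwa [show ((F : ℤ) - (((F : ℤ) - i).toNat : ℤ)) = i by omega] at this

theorem laurentFil_le_canonicalFractionalIdeal {F : ℕ} {x : k⸨X⸩}
    (hx : x ∈ laurentFil k (F + 1)) : x ∈ canonicalFractionalIdeal k H F :=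
  fun h _ => hx _ (by omega)

/-- Evaluation of the coefficient of `t ^ F` on the quotient of `k⸨t⸩` by the canonical fractional
ideal. -/
noncomputable def coeffQuotient (k : Type u) [Field k] (H : AddSubmonoid ℕ) (F : ℕ) :
    (k⸨X⸩ ⧸ canonicalFractionalIdeal k H F) →ₗ[k] k :=
  (((canonicalFractionalIdeal k H F).restrictScalars k).liftQ (laurentCoeff k F) fun x hx => by
    have := hx 0 H.zero_mem
    rwa [Nat.cast_zero, sub_zero] at this) ∘ₗ
    (Submodule.Quotient.restrictScalarsEquiv k (canonicalFractionalIdeal k H F)).symm.toLinearMap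

theorem coeffQuotient_mk {F : ℕ} (x : k⸨X⸩) :
    coeffQuotient k H F (Submodule.Quotient.mk x) = x.coeff (F : ℤ) := rfl

theorem baer_laurentSeries : Module.Baer (semigroupRing k H) k⸨X⸩ := by
  intro I g
  by_cases hI : I = ⊥
  · subst hI
    refine ⟨0, fun x hx => ?_⟩
    have : (⟨x, hx⟩ : (⊥ : Ideal (semigroupRing k H))) = 0 := Subsingleton.elim _ _
    rw [this, map_zero, LinearMap.zero_apply]
  obtain ⟨a, haI, ha0⟩ := Submodule.exists_mem_ne_zero_of_ne_bot hI
  have ha : algebraMap (semigroupRing k H) k⸨X⸩ a ≠ 0 :=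
    (map_ne_zero_iff _ algebraMap_semigroupRing_injective).mpr ha0
  refine ⟨LinearMap.toSpanSingleton _ _
    ((algebraMap (semigroupRing k H) k⸨X⸩ a)⁻¹ * g ⟨a, haI⟩), fun x hx => ?_⟩
  have h : a • g ⟨x, hx⟩ = x • g ⟨a, haI⟩ := by
    rw [← map_smul, ← map_smul]
    congr 1
    exact Subtype.ext (mul_comm _ _)
  rw [semigroupRing_smul_def, semigroupRing_smul_def] at h
  rw [LinearMap.toSpanSingleton_apply, semigroupRing_smul_def, mul_left_comm, ← h,
    inv_mul_cancel_left₀ ha]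

/-- The quotient of `k⸨t⸩` by the canonical fractional ideal is injective: it is the module of
continuous functionals on `k⟦H⟧`, through `coeffQuotient`. -/
theorem baer_laurentSeries_quotient {F : ℕ} (hF : ∀ n, F < n → n ∈ H) :
    Module.Baer (semigroupRing k H) (k⸨X⸩ ⧸ canonicalFractionalIdeal k H F) := by
  intro I g
  by_cases hI : I = ⊥
  · subst hI
    refine ⟨0, fun x hx => ?_⟩
    have : (⟨x, hx⟩ : (⊥ : Ideal (semigroupRing k H))) = 0 := Subsingleton.elim _ _
    rw [this, map_zero, LinearMap.zero_apply]
  obtain ⟨a, haI, ha0⟩ := Submodule.exists_mem_ne_zero_of_ne_bot hI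
  set a' := algebraMap (semigroupRing k H) k⸨X⸩ a with ha'
  have ha : a' ≠ 0 := (map_ne_zero_iff _ algebraMap_semigroupRing_injective).mpr ha0
  obtain ⟨y, hy⟩ := Submodule.Quotient.mk_surjective _ (g ⟨a, haI⟩)
  let ι : I.restrictScalars k →ₗ[k] k⸨X⸩ :=
    (Algebra.linearMap (semigroupRing k H) k⸨X⸩).restrictScalars k ∘ₗ
      (I.restrictScalars k).subtype
  have hι : Function.Injective ι := fun u v huv =>
    Subtype.ext (algebraMap_semigroupRing_injective huv)
  have hk : LinearMap.ker ι = ⊥ := LinearMap.ker_eq_bot_of_injective hι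
  obtain ⟨π, hπ⟩ := LinearMap.exists_leftInverse_of_injective (K := k)
    (V := I.restrictScalars k) (V' := k⸨X⸩) ι hk
  have hπ' : ∀ x : I, π (algebraMap (semigroupRing k H) k⸨X⸩ x) = x := fun x =>
    LinearMap.congr_fun hπ x
  let p : k⸨X⸩ →ₗ[k] k := coeffQuotient k H F ∘ₗ g.restrictScalars k ∘ₗ π
  have hpI : ∀ x (hx : x ∈ I), p (algebraMap (semigroupRing k H) k⸨X⸩ x) =
      coeffQuotient k H F (g ⟨x, hx⟩) := fun x hx => by
    change coeffQuotient k H F (g (π _)) = _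
    rw [hπ' ⟨x, hx⟩]
  have hp : ∀ x ∈ laurentFil k ((F + 1 + y.order.natAbs) - (a'⁻¹).order), p x = 0 := by
    intro x hx
    have h1 := mul_mem_laurentFil hx (mem_laurentFil_order a'⁻¹)
    rw [sub_add_cancel] at h1
    obtain ⟨r, hr⟩ := exists_algebraMap_eq_of_mem_laurentFil hF (laurentFil_anti (by omega) h1)
    have hx' : x = algebraMap (semigroupRing k H) k⸨X⸩ (r * a) := by
      rw [map_mul, hr, ← ha', inv_mul_cancel_right₀ ha]
    rw [hx', hpI _ (I.mul_mem_left r haI)]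
    have : g ⟨r * a, I.mul_mem_left r haI⟩ = r • g ⟨a, haI⟩ := by
      rw [← map_smul]; rfl
    rw [this, ← hy, ← Submodule.Quotient.mk_smul, coeffQuotient_mk, semigroupRing_smul_def, hr]
    exact mul_mem_laurentFil h1 (mem_laurentFil_order y) _ (by omega)
  obtain ⟨s, hs⟩ := exists_coeff_mul_eq (F : ℤ) hp
  refine ⟨LinearMap.toSpanSingleton _ _ (Submodule.Quotient.mk s), fun x hx => ?_⟩
  obtain ⟨z, hz⟩ := Submodule.Quotient.mk_surjective _ (g ⟨x, hx⟩)
  rw [LinearMap.toSpanSingleton_apply, ← hz, ← Submodule.Quotient.mk_smul,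
    Submodule.Quotient.eq, mem_canonicalFractionalIdeal_iff_forall_smul]
  intro r
  have h1 : (r • z).coeff (F : ℤ) = p (algebraMap (semigroupRing k H) k⸨X⸩ (r * x)) := by
    rw [hpI _ (I.mul_mem_left r hx), ← coeffQuotient_mk (H := H), Submodule.Quotient.mk_smul, hz,
      ← map_smul]
    rfl
  rw [smul_sub, coeff_sub, h1, hs, smul_smul,
    semigroupRing_smul_def, mul_comm, sub_self]

end CanonicalModule

/-! ### `Ext` modules of short exact sequences -/

section ExtOfModules

variable {R : Type u} [CommRing R] {X C D E : Type u} [AddCommGroup X] [AddCommGroup C]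
  [AddCommGroup D] [AddCommGroup E] [Module R X] [Module R C] [Module R D] [Module R E]

theorem shortExact_mk_ofHom {j : C →ₗ[R] D} {g : D →ₗ[R] E}
    (hj : Function.Injective j) (hjg : Function.Exact j g) (hg : Function.Surjective g) :
    (ShortComplex.mk (ModuleCat.ofHom j) (ModuleCat.ofHom g)
      (by rw [← ModuleCat.ofHom_comp, hjg.linearMap_comp_eq_zero]; rfl)).ShortExact :=
  ModuleCat.shortComplex_shortExact _ hjg hj hg

/-- The connecting homomorphism `Hom(X, E) → Ext¹(X, C)` of a short exact sequence
`0 → C → D → E → 0`: its kernel consists of the maps that lift to `D`, and it is surjective if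
`Ext¹(X, D) = 0`. -/
theorem exists_connecting_linearMap (X : Type u) [AddCommGroup X] [Module R X] {j : C →ₗ[R] D}
    {g : D →ₗ[R] E} (hj : Function.Injective j) (hjg : Function.Exact j g)
    (hg : Function.Surjective g) :
    ∃ δ : (X →ₗ[R] E) →ₗ[R] Abelian.Ext (ModuleCat.of R X) (ModuleCat.of R C) 1,
      (∀ φ, δ φ = 0 → ∃ ψ : X →ₗ[R] D, g ∘ₗ ψ = φ) ∧
      (Subsingleton (Abelian.Ext (ModuleCat.of R X) (ModuleCat.of R D) 1) →
        Function.Surjective δ) := by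
  have hS := shortExact_mk_ofHom hj hjg hg
  let e : Abelian.Ext (ModuleCat.of R E) (ModuleCat.of R C) 1 := hS.extClass
  refine ⟨{ toFun := fun φ => (Abelian.Ext.mk₀ (ModuleCat.ofHom φ)).comp e (zero_add 1)
            map_add' := fun φ ψ => ?_
            map_smul' := fun r φ => ?_ }, fun φ h => ?_, fun h x => ?_⟩
  · rw [ModuleCat.ofHom_add, Abelian.Ext.mk₀_add, Abelian.Ext.add_comp]
  · rw [RingHom.id_apply, ← Abelian.Ext.smul_comp, ← Abelian.Ext.mk₀_smul]
    rfl
  · obtain ⟨y, hy⟩ := Abelian.Ext.covariant_sequence_exact₃ _ hS _ (zero_add 1) h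
    obtain ⟨f, rfl⟩ := (Abelian.Ext.mk₀_bijective _ _).2 y
    rw [Abelian.Ext.mk₀_comp_mk₀] at hy
    exact ⟨f.hom, congrArg ModuleCat.Hom.hom ((Abelian.Ext.mk₀_bijective _ _).1 hy)⟩
  · obtain ⟨y, hy⟩ := Abelian.Ext.covariant_sequence_exact₁ _ hS x
      (Subsingleton.elim (α := Abelian.Ext (ModuleCat.of R X) (ModuleCat.of R D) 1) _ _)
      (zero_add 1)
    obtain ⟨f, rfl⟩ := (Abelian.Ext.mk₀_bijective _ _).2 y
    exact ⟨f.hom, hy⟩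

theorem subsingleton_ext_of_injective_resolution (X : Type u) [AddCommGroup X] [Module R X]
    {j : C →ₗ[R] D} {g : D →ₗ[R] E} (hj : Function.Injective j) (hjg : Function.Exact j g)
    (hg : Function.Surjective g) (hD : Module.Injective R D) (hE : Module.Injective R E) (n : ℕ) :
    Subsingleton (Abelian.Ext (ModuleCat.of R X) (ModuleCat.of R C) (n + 2)) := by
  have hS := shortExact_mk_ofHom hj hjg hg
  have h2 := Module.injective_object_of_injective_module R D
  have h3 := Module.injective_object_of_injective_module R E
  refine subsingleton_of_forall_eq 0 fun x => ?_
  obtain ⟨y, hy⟩ := Abelian.Ext.covariant_sequence_exact₁ _ hS x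
    (Abelian.Ext.eq_zero_of_injective (I := ModuleCat.of R D) (n := n + 1) _) (n₀ := n + 1) rfl
  obtain rfl : y = 0 := Abelian.Ext.eq_zero_of_injective (I := ModuleCat.of R E) y
  rw [← hy, Abelian.Ext.zero_comp]

theorem subsingleton_ext_zero_iff :
    Subsingleton (Abelian.Ext (ModuleCat.of R X) (ModuleCat.of R C) 0) ↔
      ∀ f : X →ₗ[R] C, f = 0 := by
  constructor
  · intro h f
    have := (Abelian.Ext.mk₀_bijective (ModuleCat.of R X) (ModuleCat.of R C)).1
      (Subsingleton.elim (Abelian.Ext.mk₀ (ModuleCat.ofHom f)) (Abelian.Ext.mk₀ 0))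
    exact congrArg ModuleCat.Hom.hom this
  · intro h
    refine subsingleton_of_forall_eq 0 fun x => ?_
    obtain ⟨f, rfl⟩ := (Abelian.Ext.mk₀_bijective _ _).2 x
    rw [Abelian.Ext.mk₀_eq_zero_iff]
    exact ModuleCat.hom_ext (h f.hom)

/-- An element killed by the maximal ideal is the image of `1` under a map from the residue
field. -/
theorem exists_residueField_linearMap [IsLocalRing R] {c : C}
    (hc : ∀ a ∈ maximalIdeal R, a • c = 0) :
    ∃ f : ResidueField R →ₗ[R] C, f 1 = c := by
  refine ⟨Submodule.liftQ (maximalIdeal R) (LinearMap.toSpanSingleton R C c) fun a ha => ?_, ?_⟩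
  · rw [LinearMap.mem_ker, LinearMap.toSpanSingleton_apply, hc a ha]
  · exact (Submodule.liftQ_apply _ _ _).trans (one_smul R c)

theorem residueField_linearMap_smul_apply_one [IsLocalRing R] (f : ResidueField R →ₗ[R] C) {a : R}
    (ha : a ∈ maximalIdeal R) : a • f 1 = 0 := by
  rw [← map_smul, Algebra.smul_def, mul_one]
  have : algebraMap R (ResidueField R) a = 0 := Ideal.Quotient.eq_zero_iff_mem.mpr ha
  rw [this, map_zero]

theorem residueField_linearMap_ext [IsLocalRing R] {f g : ResidueField R →ₗ[R] C}
    (h : f 1 = g 1) : f = g := by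
  ext x
  obtain ⟨r, rfl⟩ := Ideal.Quotient.mk_surjective x
  have : (Ideal.Quotient.mk (maximalIdeal R) r : ResidueField R) = r • 1 := by
    rw [Algebra.smul_def, mul_one]; rfl
  rw [this]
  exact (map_smul f r 1).trans ((congrArg (r • ·) h).trans (map_smul g r 1).symm)

theorem nonempty_residueField_equiv_hom_of_cyclic [IsLocalRing R] {f : ResidueField R →ₗ[R] C}
    (hf : f 1 ≠ 0) (h : ∀ φ : ResidueField R →ₗ[R] C, ∃ a : R, φ 1 = a • f 1) :
    Nonempty (ResidueField R ≃ₗ[R] (ResidueField R →ₗ[R] C)) := by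
  refine ⟨LinearEquiv.ofBijective ((LinearMap.mul R (ResidueField R)).compr₂ f) ⟨?_, fun φ => ?_⟩⟩
  · rw [← LinearMap.ker_eq_bot, LinearMap.ker_eq_bot']
    intro a ha
    have h1 : f a = 0 := by simpa using LinearMap.congr_fun ha 1
    by_contra h0
    obtain ⟨r, hr⟩ := IsLocalRing.residue_surjective (R := R) a⁻¹
    have h2 : r • a = 1 := by
      rw [Algebra.smul_def]
      exact (congrArg (· * a) hr).trans (inv_mul_cancel₀ h0)
    exact hf (by rw [← h2, map_smul, h1, smul_zero])
  · obtain ⟨a, ha⟩ := h φ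
    refine ⟨algebraMap R _ a, residueField_linearMap_ext ?_⟩
    rw [LinearMap.compr₂_apply, LinearMap.mul_apply', ← Algebra.smul_def, map_smul, ha]

/-- A finite module over a one-dimensional local ring with an injective resolution
`0 → C → D → E → 0` such that `D` has no socle and `E` has a one-dimensional socle is a canonical
module. -/
theorem isCanonicalModule_of_injective_resolution [IsLocalRing R] (hR : ringKrullDim R = 1)
    (hC : Module.Finite R C) {j : C →ₗ[R] D} {g : D →ₗ[R] E} (hj : Function.Injective j)
    (hjg : Function.Exact j g) (hg : Function.Surjective g) (hD : Module.Injective R D)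
    (hE : Module.Injective R E) (hκ : ∀ f : ResidueField R →ₗ[R] D, f = 0)
    (e : ResidueField R ≃ₗ[R] (ResidueField R →ₗ[R] E)) : IsCanonicalModule R C := by
  refine ⟨hC, fun i hi => ?_, fun i hi => ?_⟩
  · rw [hR] at hi
    obtain rfl : i = 1 := by exact_mod_cast hi
    obtain ⟨δ, hδ, hδ'⟩ := exists_connecting_linearMap (ResidueField R) hj hjg hg
    have hsurj := hδ' (by
      have := Module.injective_object_of_injective_module R D
      exact Abelian.Ext.subsingleton_of_injective _ (ModuleCat.of R D) 0)
    have hinj : Function.Injective δ := by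
      rw [← LinearMap.ker_eq_bot, LinearMap.ker_eq_bot']
      intro φ h
      obtain ⟨ψ, rfl⟩ := hδ φ h
      rw [hκ ψ, LinearMap.comp_zero]
    exact ⟨(e.trans (LinearEquiv.ofBijective δ ⟨hinj, hsurj⟩)).symm⟩
  · rw [hR] at hi
    match i, hi with
    | 0, _ =>
      rw [subsingleton_ext_zero_iff]
      intro f
      ext x
      refine hj ?_
      rw [LinearMap.zero_apply, map_zero]
      exact LinearMap.congr_fun (hκ (j ∘ₗ f)) x
    | 1, hi => exact absurd Nat.cast_one hi
    | n + 2, _ => exact subsingleton_ext_of_injective_resolution _ hj hjg hg hD hE n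

end ExtOfModules

/-! ### Existence of the canonical module -/

section Existence

variable {k : Type u} [Field k] {H : AddSubmonoid ℕ}

theorem finite_canonicalFractionalIdeal {F : ℕ} (hF : ∀ n, F < n → n ∈ H) :
    Module.Finite (semigroupRing k H) (canonicalFractionalIdeal k H F) := by
  refine Module.Finite.iff_fg.mpr ?_
  -- The monomials `t ^ n ∈ K` with `n < 2F + 2` generate: the series of order at least `2F + 2`
  -- are multiples of `t ^ (F + 1)` by elements of the conductor.
  let S : Set k⸨X⸩ := ((fun n : ℤ => (single n 1 : k⸨X⸩)) '' Finset.Ico (0 : ℤ) (2 * F + 2)) ∩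
    canonicalFractionalIdeal k H F
  have hS : S.Finite := Set.Finite.inter_of_left ((Finset.finite_toSet _).image _) _
  refine Submodule.fg_def.mpr ⟨S, hS, le_antisymm (Submodule.span_le.mpr Set.inter_subset_right)
    fun x hx => ?_⟩
  have h1 := sub_sum_single_mem_laurentFil (canonicalFractionalIdeal_le_laurentFil hF hx)
    (2 * F + 2)
  rw [← sub_add_cancel x (∑ i ∈ Finset.Ico (0 : ℤ) (2 * F + 2), single i (x.coeff i))]
  refine Submodule.add_mem _ ?_ (Submodule.sum_mem _ fun i hi => ?_)
  · have h2 := mul_mem_laurentFil h1 (single_mem_laurentFil (k := k) (-(F + 1)) 1)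
    obtain ⟨r, hr⟩ := exists_algebraMap_eq_of_mem_laurentFil hF (laurentFil_anti (by omega) h2)
    have h3 : (single ((F : ℤ) + 1) 1 : k⸨X⸩) ∈ S :=
      ⟨⟨_, by simp; omega, rfl⟩,
        laurentFil_le_canonicalFractionalIdeal (single_mem_laurentFil _ _)⟩
    have h4 := Submodule.smul_mem _ r (Submodule.subset_span (R := semigroupRing k H) h3)
    rwa [semigroupRing_smul_def, hr, mul_assoc, HahnSeries.single_mul_single, neg_add_cancel,
      mul_one, HahnSeries.single_zero_one, mul_one] at h4
  · by_cases h0 : x.coeff i = 0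
    · rw [h0, HahnSeries.single_eq_zero]
      exact Submodule.zero_mem _
    · have h3 : (single i 1 : k⸨X⸩) ∈ S := by
        refine ⟨⟨_, hi, rfl⟩, fun h hh => coeff_single_of_ne ?_⟩
        rintro rfl
        exact h0 (hx h hh)
      rw [single_eq_smul, ← algebraMap_smul (semigroupRing k H)]
      exact Submodule.smul_mem _ _ (Submodule.subset_span h3)

/-- The socle of `k⸨t⸩ / K` is spanned by the class of `t ^ F`. -/
theorem sub_single_mem_canonicalFractionalIdeal {F : ℕ} {s : k⸨X⸩}
    (hs : ∀ a ∈ maximalIdeal (semigroupRing k H), a • s ∈ canonicalFractionalIdeal k H F) :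
    s - single (F : ℤ) (s.coeff F) ∈ canonicalFractionalIdeal k H F := by
  intro h hh
  by_cases h0 : h = 0
  · simp [h0]
  · obtain ⟨a, ha, ha'⟩ := exists_mem_maximalIdeal_eq_single (k := k) hh h0
    have h1 := hs a ha 0 H.zero_mem
    rw [semigroupRing_smul_def, ha', coeff_single_mul', one_mul, Nat.cast_zero, sub_zero] at h1
    rw [coeff_sub, h1, coeff_single_of_ne (by omega), sub_zero]

theorem smul_single_mem_canonicalFractionalIdeal {F : ℕ} {a : semigroupRing k H}
    (ha : a ∈ maximalIdeal (semigroupRing k H)) (c : k) :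
    a • (single (F : ℤ) c : k⸨X⸩) ∈ canonicalFractionalIdeal k H F := by
  refine laurentFil_le_canonicalFractionalIdeal ?_
  rw [semigroupRing_smul_def, add_comm]
  exact mul_mem_laurentFil (algebraMap_mem_laurentFil_one ha) (single_mem_laurentFil _ _)

theorem nonempty_residueField_equiv_hom {F : ℕ} :
    Nonempty (ResidueField (semigroupRing k H) ≃ₗ[semigroupRing k H]
      (ResidueField (semigroupRing k H) →ₗ[semigroupRing k H]
        k⸨X⸩ ⧸ canonicalFractionalIdeal k H F)) := by
  obtain ⟨f, hf⟩ := exists_residueField_linearMap (R := semigroupRing k H)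
    (c := (Submodule.Quotient.mk (single (F : ℤ) 1) : k⸨X⸩ ⧸ canonicalFractionalIdeal k H F))
    fun a ha => by
      rw [← Submodule.Quotient.mk_smul, Submodule.Quotient.mk_eq_zero]
      exact smul_single_mem_canonicalFractionalIdeal ha 1
  refine nonempty_residueField_equiv_hom_of_cyclic (f := f) (fun h => ?_) fun φ => ?_
  · rw [hf, Submodule.Quotient.mk_eq_zero] at h
    have := h 0 H.zero_mem
    simp at this
  · obtain ⟨s, hs⟩ := Submodule.Quotient.mk_surjective _ (φ 1)
    refine ⟨algebraMap k _ (s.coeff F), ?_⟩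
    rw [hf, ← hs, ← Submodule.Quotient.mk_smul, algebraMap_smul, ← single_eq_smul,
      Submodule.Quotient.eq]
    refine sub_single_mem_canonicalFractionalIdeal fun a ha => ?_
    rw [← Submodule.Quotient.mk_eq_zero, Submodule.Quotient.mk_smul, hs]
    exact residueField_linearMap_smul_apply_one φ ha

/-- The canonical fractional ideal `K` is a canonical module: `0 → K → k⸨t⸩ → k⸨t⸩ / K → 0` is an
injective resolution, and the socle of `k⸨t⸩ / K` is one-dimensional. -/
theorem isCanonicalModule_canonicalFractionalIdeal {F : ℕ} (hF : ∀ n, F < n → n ∈ H) :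
    IsCanonicalModule (semigroupRing k H) (canonicalFractionalIdeal k H F) := by
  obtain ⟨e⟩ := nonempty_residueField_equiv_hom (k := k) (H := H) (F := F)
  have hD : Module.Injective (semigroupRing k H) k⸨X⸩ := baer_laurentSeries.injective
  have hE := (baer_laurentSeries_quotient (k := k) hF).injective
  have hκ : ∀ f : ResidueField (semigroupRing k H) →ₗ[semigroupRing k H] k⸨X⸩, f = 0 := by
    intro f
    obtain ⟨a, ha, ha0⟩ :=
      Submodule.exists_mem_ne_zero_of_ne_bot (maximalIdeal_semigroupRing_ne_bot (k := k) hF)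
    have h := residueField_linearMap_smul_apply_one f ha
    rw [semigroupRing_smul_def] at h
    exact residueField_linearMap_ext ((mul_eq_zero.mp h).resolve_left
      ((map_ne_zero_iff _ algebraMap_semigroupRing_injective).mpr ha0))
  have h := isCanonicalModule_of_injective_resolution (R := semigroupRing k H)
    (C := canonicalFractionalIdeal k H F) (D := k⸨X⸩) (E := k⸨X⸩ ⧸ canonicalFractionalIdeal k H F)
    (ringKrullDim_semigroupRing hF) (finite_canonicalFractionalIdeal hF)
    (j := (canonicalFractionalIdeal k H F).subtype)
    (canonicalFractionalIdeal k H F).injective_subtype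
    (LinearMap.exact_subtype_mkQ _) (canonicalFractionalIdeal k H F).mkQ_surjective
  exact h hD hE hκ e

end Existence

/-! ### Lattices in vector spaces over `k⸨t⸩` -/

section Lattices

theorem exists_dual_apply_ne_zero {K V : Type*} [Field K] [AddCommGroup V] [Module K V] {v : V}
    (hv : v ≠ 0) : ∃ ψ : V →ₗ[K] K, ψ v ≠ 0 := by
  by_contra! h
  exact hv ((Module.forall_dual_apply_eq_zero_iff K v).mp h)

variable {k : Type u} [Field k] {H : AddSubmonoid ℕ}

/-- A homomorphism from a finite `k⟦H⟧`-module to `k⸨t⸩` has bounded denominators. -/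
theorem exists_forall_mem_laurentFil {M : Type*} [AddCommGroup M] [Module (semigroupRing k H) M]
    [Module.Finite (semigroupRing k H) M] (f : M →ₗ[semigroupRing k H] k⸨X⸩) :
    ∃ N : ℤ, ∀ m, f m ∈ laurentFil k N := by
  obtain ⟨S, hS⟩ := Module.Finite.fg_top (R := semigroupRing k H) (M := M)
  obtain ⟨N, hN⟩ : ∃ N : ℤ, ∀ s ∈ S, N ≤ (f s).order := by
    obtain ⟨N, hN⟩ := (S.image fun s => (f s).order).bddBelow
    exact ⟨N, fun s hs => hN (Finset.mem_coe.mpr (Finset.mem_image_of_mem _ hs))⟩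
  refine ⟨N, fun m => ?_⟩
  have hm : m ∈ Submodule.span (semigroupRing k H) (S : Set M) := hS ▸ Submodule.mem_top
  induction hm using Submodule.span_induction with
  | mem x hx => exact laurentFil_anti (hN x hx) (mem_laurentFil_order _)
  | zero => rw [map_zero]; exact Submodule.zero_mem _
  | add x y _ _ hx hy => rw [map_add]; exact Submodule.add_mem _ hx hy
  | smul r x _ hx =>
    rw [map_smul, semigroupRing_smul_def]
    simpa using mul_mem_laurentFil (algebraMap_mem_laurentFil r) hx

variable {M : Type u} [AddCommGroup M] [Module (semigroupRing k H) M]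

/-- The map from `M` to its generic fibre `k⸨t⸩ ⊗ M`. -/
noncomputable def toGenericFibre (k : Type u) [Field k] (H : AddSubmonoid ℕ) (M : Type u)
    [AddCommGroup M] [Module (semigroupRing k H) M] :
    M →ₗ[semigroupRing k H] TensorProduct (semigroupRing k H) k⸨X⸩ M :=
  TensorProduct.mk (semigroupRing k H) k⸨X⸩ M 1

theorem toGenericFibre_injective {F : ℕ} (hF : ∀ n, F < n → n ∈ H)
    (hM : ∀ (r : semigroupRing k H) (m : M), r • m = 0 → r = 0 ∨ m = 0) :
    Function.Injective (toGenericFibre k H M) := by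
  have := isFractionRing_laurentSeries (k := k) hF
  have hloc : IsLocalizedModule (nonZeroDivisors (semigroupRing k H)) (toGenericFibre k H M) :=
    (isLocalizedModule_iff_isBaseChange (nonZeroDivisors (semigroupRing k H)) k⸨X⸩ _).mpr
      (TensorProduct.isBaseChange _ _ _)
  rw [← LinearMap.ker_eq_bot, LinearMap.ker_eq_bot']
  intro m hm
  obtain ⟨c, hc⟩ := (IsLocalizedModule.eq_zero_iff (nonZeroDivisors (semigroupRing k H)) _).mp hm
  exact (hM c m hc).resolve_left (nonZeroDivisors.coe_ne_zero c)

theorem exists_laurentFil_smul_mem_range {F : ℕ} (hF : ∀ n, F < n → n ∈ H)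
    (v : TensorProduct (semigroupRing k H) k⸨X⸩ M) :
    ∃ N : ℤ, ∀ x ∈ laurentFil k N, x • v ∈ LinearMap.range (toGenericFibre k H M) := by
  induction v with
  | zero => exact ⟨0, fun x _ => by rw [smul_zero]; exact Submodule.zero_mem _⟩
  | tmul y m =>
    refine ⟨F + 1 - y.order, fun x hx => ?_⟩
    have h := mul_mem_laurentFil hx (mem_laurentFil_order y)
    rw [sub_add_cancel] at h
    obtain ⟨r, hr⟩ := exists_algebraMap_eq_of_mem_laurentFil hF h
    refine ⟨r • m, ?_⟩
    rw [TensorProduct.smul_tmul', smul_eq_mul, ← hr, Algebra.algebraMap_eq_smul_one,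
      TensorProduct.smul_tmul]
    rfl
  | add v w hv hw =>
    obtain ⟨a, ha⟩ := hv
    obtain ⟨b, hb⟩ := hw
    refine ⟨max a b, fun x hx => ?_⟩
    rw [smul_add]
    exact Submodule.add_mem _ (ha x (laurentFil_anti (le_max_left _ _) hx))
      (hb x (laurentFil_anti (le_max_right _ _) hx))

/-- A finite module contains no line of its generic fibre. -/
theorem eq_zero_of_forall_smul_mem_range [Module.Finite (semigroupRing k H) M]
    {v : TensorProduct (semigroupRing k H) k⸨X⸩ M}
    (hv : ∀ x : k⸨X⸩, x • v ∈ LinearMap.range (toGenericFibre k H M)) : v = 0 := by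
  by_contra h0
  obtain ⟨ψ, hψ⟩ := exists_dual_apply_ne_zero (K := k⸨X⸩) h0
  obtain ⟨N, hN⟩ := exists_forall_mem_laurentFil
    (ψ.restrictScalars (semigroupRing k H) ∘ₗ toGenericFibre k H M)
  obtain ⟨m, hm⟩ := hv (single (N - 1) 1 * (ψ v)⁻¹)
  have h := hN m (N - 1) (by omega)
  rw [LinearMap.comp_apply, hm, LinearMap.restrictScalars_apply, map_smul, smul_eq_mul,
    inv_mul_cancel_right₀ hψ, coeff_single_same] at h
  exact one_ne_zero h

end Lattices

/-! ### Lattices with one-dimensional socle quotient -/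

section Uniqueness

variable {k : Type u} [Field k] {H : AddSubmonoid ℕ}

/-- A lattice `M` in a `k⸨t⸩`-vector space `V` such that the socle of `V / M` is one-dimensional is
isomorphic to the canonical fractional ideal. A functional `p` on `V / M` that does not vanish on
the socle gives a `k⸨t⸩`-linear map `Ψ : V → k⸨t⸩` with `p (x • v) = coeff F (x * Ψ v)`, and `M` is
the preimage of the canonical fractional ideal under `Ψ`. As `M` contains no line, `Ψ` is
injective, so that `V` has dimension one. -/
theorem nonempty_equiv_canonicalFractionalIdeal_of_socle {F : ℕ} (hF : ∀ n, F < n → n ∈ H)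
    {M V : Type*} [AddCommGroup M] [Module (semigroupRing k H) M] [AddCommGroup V]
    [Module k⸨X⸩ V] [Module (semigroupRing k H) V] [IsScalarTower (semigroupRing k H) k⸨X⸩ V]
    (ι : M →ₗ[semigroupRing k H] V) (hι : Function.Injective ι)
    (hbdd : ∀ v : V, ∃ N : ℤ, ∀ x ∈ laurentFil k N, x • v ∈ LinearMap.range ι)
    (hsep : ∀ v : V, (∀ x : k⸨X⸩, x • v ∈ LinearMap.range ι) → v = 0)
    (hsoc : ∀ s₁ s₂ : V,
      (∀ a ∈ maximalIdeal (semigroupRing k H), a • s₁ ∈ LinearMap.range ι) →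
      (∀ a ∈ maximalIdeal (semigroupRing k H), a • s₂ ∈ LinearMap.range ι) →
      ∃ a b : semigroupRing k H, (a ∉ maximalIdeal (semigroupRing k H) ∨
        b ∉ maximalIdeal (semigroupRing k H)) ∧ a • s₁ + b • s₂ ∈ LinearMap.range ι)
    (hne : ∃ v : V, v ∉ LinearMap.range ι) :
    Nonempty (M ≃ₗ[semigroupRing k H] canonicalFractionalIdeal k H F) := by
  let _ : Module k V := Module.compHom V (algebraMap k (semigroupRing k H))
  have htower : ∀ (c : k) (v : V), c • v = algebraMap k (semigroupRing k H) c • v :=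
    fun _ _ => rfl
  have : IsScalarTower k (semigroupRing k H) V := IsScalarTower.of_algebraMap_smul fun _ _ => rfl
  have : IsScalarTower k k⸨X⸩ V := ⟨fun c x v => by
    rw [htower, ← smul_assoc, algebraMap_smul]⟩
  have hsoc : ∀ s₁ s₂ : V,
      (∀ a ∈ maximalIdeal (semigroupRing k H), a • s₁ ∈ LinearMap.range ι) →
      (∀ a ∈ maximalIdeal (semigroupRing k H), a • s₂ ∈ LinearMap.range ι) →
      ∃ a b : k, (a ≠ 0 ∨ b ≠ 0) ∧ a • s₁ + b • s₂ ∈ LinearMap.range ι := by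
    intro s₁ s₂ h₁ h₂
    obtain ⟨a, b, hab, h⟩ := hsoc s₁ s₂ h₁ h₂
    obtain ⟨c, hc⟩ := exists_sub_mem_maximalIdeal a
    obtain ⟨d, hd⟩ := exists_sub_mem_maximalIdeal b
    refine ⟨c, d, ?_, ?_⟩
    · by_contra! h0
      rw [h0.1, map_zero, sub_zero] at hc
      rw [h0.2, map_zero, sub_zero] at hd
      exact hab.elim (fun h => h hc) fun h => h hd
    · have := Submodule.sub_mem _ h (Submodule.add_mem _ (h₁ _ hc) (h₂ _ hd))
      rw [htower, htower]
      convert this using 1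
      rw [sub_smul, sub_smul]
      abel
  have hW : ∀ {c : k} {v : V}, c ≠ 0 → c • v ∈ LinearMap.range ι → v ∈ LinearMap.range ι := by
    intro c v hc h
    have := (LinearMap.range ι).smul_mem (algebraMap k (semigroupRing k H) c⁻¹) h
    rwa [← htower, smul_smul, inv_mul_cancel₀ hc, one_smul] at this
  have hex : ∀ v ∉ LinearMap.range ι, ∃ r : semigroupRing k H, r • v ∉ LinearMap.range ι ∧
      ∀ a ∈ maximalIdeal (semigroupRing k H), a • r • v ∈ LinearMap.range ι := by
    intro v hv
    obtain ⟨N, hN⟩ := hbdd v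
    obtain ⟨r, hr⟩ := exists_algebraMap_eq_of_mem_laurentFil (k := k) hF
      (x := single (max N (F + 1)) 1)
      (laurentFil_anti (le_max_right _ _) (single_mem_laurentFil _ _))
    have hr0 : r ≠ 0 := by
      rintro rfl
      rw [map_zero] at hr
      exact single_ne_zero one_ne_zero hr.symm
    obtain ⟨s, hs, hs'⟩ := exists_smul_ne_zero_of_torsion hF
      (c := (Submodule.Quotient.mk v : V ⧸ LinearMap.range ι))
      (by rwa [ne_eq, Submodule.Quotient.mk_eq_zero]) hr0 (by
        rw [← Submodule.Quotient.mk_smul, Submodule.Quotient.mk_eq_zero,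
          ← algebraMap_smul k⸨X⸩ r v, hr]
        exact hN _ (laurentFil_anti (le_max_left _ _) (single_mem_laurentFil _ _)))
    refine ⟨s, fun h => hs ?_, fun a ha => ?_⟩
    · rwa [← Submodule.Quotient.mk_smul, Submodule.Quotient.mk_eq_zero]
    · rw [← Submodule.Quotient.mk_eq_zero, Submodule.Quotient.mk_smul, Submodule.Quotient.mk_smul]
      exact hs' a ha
  obtain ⟨v₀, hv₀⟩ := hne
  obtain ⟨σ, hσ, hσm⟩ : ∃ σ ∉ LinearMap.range ι,
      ∀ a ∈ maximalIdeal (semigroupRing k H), a • σ ∈ LinearMap.range ι := by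
    obtain ⟨r, h⟩ := hex v₀ hv₀
    exact ⟨r • v₀, h⟩
  obtain ⟨p, hpσ, hpker⟩ := Submodule.exists_le_ker_of_notMem
    (p := (LinearMap.range ι).restrictScalars k) (v := σ) hσ
  have hpW : ∀ w ∈ LinearMap.range ι, p w = 0 := fun w hw => hpker hw
  -- A vector on whose `k⟦H⟧`-multiples `p` vanishes lies in `M`.
  have hker : ∀ v : V, (∀ r : semigroupRing k H, p (r • v) = 0) → v ∈ LinearMap.range ι := by
    intro v hv
    by_contra hvW
    obtain ⟨r, hr, hrm⟩ := hex v hvW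
    obtain ⟨a, b, hab, h⟩ := hsoc σ (r • v) hσm hrm
    have h1 := hpW _ h
    rw [map_add, map_smul, map_smul, hv r, smul_zero, add_zero, smul_eq_mul] at h1
    have ha : a = 0 := (mul_eq_zero.mp h1).resolve_right hpσ
    rw [ha, zero_smul, zero_add] at h
    exact hr (hW (hab.resolve_left (not_not.mpr ha)) h)
  have hrep : ∀ v : V, ∃ y : k⸨X⸩, ∀ x : k⸨X⸩, p (x • v) = (y * x).coeff (F : ℤ) := by
    intro v
    obtain ⟨N, hN⟩ := hbdd v
    exact exists_coeff_mul_eq (F : ℤ)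
      (p := p ∘ₗ (LinearMap.toSpanSingleton k⸨X⸩ V v).restrictScalars k)
      fun x hx => hpW _ (hN x hx)
  choose Ψ hΨ using hrep
  have hΨadd : ∀ v w, Ψ (v + w) = Ψ v + Ψ w := fun v w =>
    eq_of_forall_coeff_mul_eq (F := F) fun x => by
      rw [← hΨ, add_mul, coeff_add, ← hΨ, ← hΨ, smul_add, map_add]
  have hΨmul : ∀ (x : k⸨X⸩) v, Ψ (x • v) = x * Ψ v := fun x v =>
    eq_of_forall_coeff_mul_eq (F := F) fun z => by
      rw [← hΨ, smul_smul, hΨ, mul_comm z x, mul_left_comm, mul_assoc]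
  have hΨsmul : ∀ (r : semigroupRing k H) v, Ψ (r • v) = r • Ψ v := fun r v => by
    rw [← algebraMap_smul k⸨X⸩ r v, hΨmul, semigroupRing_smul_def]
  have hpr : ∀ (r : semigroupRing k H) v, p (r • v) = (r • Ψ v).coeff (F : ℤ) := fun r v => by
    rw [← algebraMap_smul k⸨X⸩ r v, hΨ, semigroupRing_smul_def, mul_comm]
  have hΨinj : ∀ v, Ψ v = 0 → v = 0 := fun v hv => hsep v fun x => hker _ fun r => by
    rw [hpr, hΨmul, hv, mul_zero, smul_zero, HahnSeries.coeff_zero]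
  have hΨW : ∀ v, Ψ v ∈ canonicalFractionalIdeal k H F ↔ v ∈ LinearMap.range ι := fun v => by
    rw [mem_canonicalFractionalIdeal_iff_forall_smul]
    refine ⟨fun h => hker v fun r => (hpr r v).trans (h r), fun h r => ?_⟩
    rw [← hpr]
    exact hpW _ (Submodule.smul_mem _ r h)
  have hΨσ : Ψ σ ≠ 0 := fun h => hpσ (by
    have := hΨ σ 1
    rwa [h, zero_mul, one_smul, HahnSeries.coeff_zero] at this)
  let f : M →ₗ[semigroupRing k H] canonicalFractionalIdeal k H F :=
    { toFun := fun m => ⟨Ψ (ι m), (hΨW _).mpr ⟨m, rfl⟩⟩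
      map_add' := fun m n => Subtype.ext (by simp [hΨadd])
      map_smul' := fun r m => Subtype.ext (by simp [hΨsmul]) }
  refine ⟨LinearEquiv.ofBijective f ⟨?_, fun y => ?_⟩⟩
  · refine (injective_iff_map_eq_zero f).mpr fun m hm => ?_
    have h1 : Ψ (ι m) = 0 := congrArg Subtype.val hm
    exact hι ((hΨinj _ h1).trans (map_zero ι).symm)
  · have h1 : Ψ (((y : k⸨X⸩) * (Ψ σ)⁻¹) • σ) = y := by
      rw [hΨmul, inv_mul_cancel_right₀ hΨσ]
    obtain ⟨m, hm⟩ := (hΨW _).mp (h1 ▸ y.2)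
    exact ⟨m, Subtype.ext ((congrArg Ψ hm).trans h1)⟩

end Uniqueness

/-! ### The socle and `Ext¹` of the residue field -/

section SocleFromExt

variable {R : Type u} [CommRing R] [IsLocalRing R] {M V : Type u} [AddCommGroup M]
  [AddCommGroup V] [Module R M] [Module R V]

/-- If `V` has no socle and `Ext¹(κ, M)` is one-dimensional, then so is the socle of `V / M`. -/
theorem exists_smul_add_smul_mem_range {ι : M →ₗ[R] V} (hι : Function.Injective ι)
    (hV : ∀ f : ResidueField R →ₗ[R] V, f = 0)
    (e : Abelian.Ext (ModuleCat.of R (ResidueField R)) (ModuleCat.of R M) 1 ≃ₗ[R] ResidueField R)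
    {s₁ s₂ : V} (h₁ : ∀ a ∈ maximalIdeal R, a • s₁ ∈ LinearMap.range ι)
    (h₂ : ∀ a ∈ maximalIdeal R, a • s₂ ∈ LinearMap.range ι) :
    ∃ a b : R, (a ∉ maximalIdeal R ∨ b ∉ maximalIdeal R) ∧ a • s₁ + b • s₂ ∈ LinearMap.range ι := by
  obtain ⟨δ, hδ, -⟩ := exists_connecting_linearMap (ResidueField R) hι
    (LinearMap.exact_map_mkQ_range ι) (LinearMap.range ι).mkQ_surjective
  have hδ0 : ∀ φ, δ φ = 0 → φ = 0 := fun φ h => by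
    obtain ⟨ψ, rfl⟩ := hδ φ h
    rw [hV ψ, LinearMap.comp_zero]
  have hmk : ∀ {s : V}, (∀ a ∈ maximalIdeal R, a • s ∈ LinearMap.range ι) →
      ∃ f : ResidueField R →ₗ[R] V ⧸ LinearMap.range ι, f 1 = Submodule.Quotient.mk s :=
    fun h => exists_residueField_linearMap fun a ha => by
      rw [← Submodule.Quotient.mk_smul, Submodule.Quotient.mk_eq_zero]
      exact h a ha
  obtain ⟨φ₁, hφ₁⟩ := hmk h₁
  obtain ⟨φ₂, hφ₂⟩ := hmk h₂
  obtain ⟨c₁, hc₁⟩ := IsLocalRing.residue_surjective (e (δ φ₁))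
  obtain ⟨c₂, hc₂⟩ := IsLocalRing.residue_surjective (e (δ φ₂))
  have hrel : ∀ a b : R, a * c₁ + b * c₂ ∈ maximalIdeal R →
      a • s₁ + b • s₂ ∈ LinearMap.range ι := by
    intro a b hab
    have h : e (δ (a • φ₁ + b • φ₂)) = 0 := by
      rw [map_add, map_add, map_smul, map_smul, map_smul, map_smul, ← hc₁, ← hc₂,
        Algebra.smul_def, Algebra.smul_def]
      change residue R a * residue R c₁ + residue R b * residue R c₂ = 0
      rw [← map_mul, ← map_mul, ← map_add, residue_eq_zero_iff]
      exact hab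
    have h' := LinearMap.congr_fun (hδ0 _ ((LinearEquiv.map_eq_zero_iff e).mp h)) 1
    rw [LinearMap.add_apply, LinearMap.smul_apply, LinearMap.smul_apply, hφ₁, hφ₂] at h'
    rw [← Submodule.Quotient.mk_eq_zero]
    exact h'
  by_cases h : c₁ ∈ maximalIdeal R
  · exact ⟨1, 0, Or.inl ((Ideal.ne_top_iff_one _).mp Ideal.IsPrime.ne_top'),
      hrel 1 0 (by simpa using h)⟩
  · exact ⟨c₂, -c₁, Or.inr (fun h' => h ((neg_mem_iff).mp h')),
      hrel _ _ (by rw [neg_mul, mul_comm, add_neg_cancel]; exact zero_mem _)⟩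

theorem eq_zero_of_subsingleton_ext_zero
    (h : Subsingleton (Abelian.Ext (ModuleCat.of R (ResidueField R)) (ModuleCat.of R M) 0))
    {c : M} (hc : ∀ a ∈ maximalIdeal R, a • c = 0) : c = 0 := by
  obtain ⟨f, hf⟩ := exists_residueField_linearMap hc
  rw [← hf, subsingleton_ext_zero_iff.mp h f, LinearMap.zero_apply]

theorem nontrivial_of_ext_one_equiv
    (e : Abelian.Ext (ModuleCat.of R (ResidueField R)) (ModuleCat.of R M) 1 ≃ₗ[R] ResidueField R) :
    Nontrivial M := by
  by_contra h
  rw [not_nontrivial_iff_subsingleton] at h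
  have : Module.Injective R M := ⟨fun _ _ _ _ _ _ _ _ _ => ⟨0, fun _ => Subsingleton.elim _ _⟩⟩
  have := Module.injective_object_of_injective_module R M
  have h1 := Abelian.Ext.eq_zero_of_injective (e.symm 1)
  exact one_ne_zero ((LinearEquiv.map_eq_zero_iff e.symm).mp h1)

end SocleFromExt

/-! ### Uniqueness of the canonical module -/

section Uniqueness

variable {k : Type u} [Field k] {H : AddSubmonoid ℕ}

theorem smul_eq_zero_of_forall_socle_eq_zero {F : ℕ} (hF : ∀ n, F < n → n ∈ H) {N : Type*}
    [AddCommGroup N] [Module (semigroupRing k H) N]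
    (hN : ∀ c : N, (∀ a ∈ maximalIdeal (semigroupRing k H), a • c = 0) → c = 0)
    (r : semigroupRing k H) (c : N) (h : r • c = 0) : r = 0 ∨ c = 0 := by
  by_contra! hcon
  obtain ⟨s, hs, hs'⟩ := exists_smul_ne_zero_of_torsion hF hcon.2 hcon.1 h
  exact hs (hN _ hs')

/-- Every canonical module of `k⟦H⟧` is isomorphic to the canonical fractional ideal. -/
theorem nonempty_equiv_canonicalFractionalIdeal {F : ℕ} (hF : ∀ n, F < n → n ∈ H) {M : Type u}
    [AddCommGroup M] [Module (semigroupRing k H) M]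
    (hM : IsCanonicalModule (semigroupRing k H) M) :
    Nonempty (M ≃ₗ[semigroupRing k H] canonicalFractionalIdeal k H F) := by
  have := hM.finite
  have hdim := ringKrullDim_semigroupRing (k := k) hF
  obtain ⟨e⟩ := hM.ext_residueField_dim 1 (by rw [hdim]; rfl)
  have htf := smul_eq_zero_of_forall_socle_eq_zero hF (N := M) fun c hc =>
    eq_zero_of_subsingleton_ext_zero
      (hM.ext_residueField_eq_zero 0 (by rw [hdim]; exact zero_ne_one)) hc
  have hι := toGenericFibre_injective hF htf
  have hV : ∀ f : ResidueField (semigroupRing k H) →ₗ[semigroupRing k H]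
      TensorProduct (semigroupRing k H) k⸨X⸩ M, f = 0 := by
    intro f
    obtain ⟨a, ha, ha0⟩ :=
      Submodule.exists_mem_ne_zero_of_ne_bot (maximalIdeal_semigroupRing_ne_bot (k := k) hF)
    have h := residueField_linearMap_smul_apply_one f ha
    rw [← algebraMap_smul k⸨X⸩ a (f 1)] at h
    exact residueField_linearMap_ext ((smul_eq_zero.mp h).resolve_left
      ((map_ne_zero_iff _ algebraMap_semigroupRing_injective).mpr ha0))
  refine nonempty_equiv_canonicalFractionalIdeal_of_socle hF (toGenericFibre k H M) hι
    (exists_laurentFil_smul_mem_range hF) (fun v => eq_zero_of_forall_smul_mem_range)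
    (fun _ _ => exists_smul_add_smul_mem_range hι hV e) ?_
  by_contra! h
  have := nontrivial_of_ext_one_equiv e
  obtain ⟨m, hm⟩ := exists_ne (0 : M)
  refine hm (hι ?_)
  rw [map_zero]
  exact eq_zero_of_forall_smul_mem_range fun x => h _

end Uniqueness

/-! ### Semidualizing modules as fractional ideals -/

/-- A semidualizing module has no socle: a nonzero element killed by the maximal ideal would give
a nonzero endomorphism `C → κ → C` killed by the maximal ideal, whereas `End C = R` is a domain. -/
theorem IsSemidualizing.eq_zero_of_maximalIdeal_smul {R : Type u} [CommRing R] [IsDomain R]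
    [IsLocalRing R] (hR : maximalIdeal R ≠ ⊥) {C : Type u} [AddCommGroup C] [Module R C]
    (hC : IsSemidualizing R C) {c : C} (hc : ∀ a ∈ maximalIdeal R, a • c = 0) : c = 0 := by
  by_contra h0
  have := hC.finite
  have : Nontrivial C := ⟨c, 0, h0⟩
  obtain ⟨N, hN, -⟩ := (eq_top_or_exists_le_coatom (⊥ : Submodule R C)).resolve_left bot_ne_top
  obtain ⟨I, hI, ⟨e⟩⟩ := isSimpleModule_iff_quot_maximal.mp (isSimpleModule_iff_isCoatom.mpr hN)
  rw [IsLocalRing.eq_maximalIdeal hI] at e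
  let g : R ⧸ maximalIdeal R →ₗ[R] C :=
    Submodule.liftQ (maximalIdeal R) (LinearMap.toSpanSingleton R C c) fun a ha => hc a ha
  have hg : ∀ a ∈ maximalIdeal R, ∀ y, a • g y = 0 := by
    intro a ha y
    obtain ⟨r, rfl⟩ := Submodule.Quotient.mk_surjective _ y
    change a • r • c = 0
    rw [smul_comm, hc a ha, smul_zero]
  obtain ⟨ρ, hρ⟩ := hC.homothety_bijective.2 (g ∘ₗ e.toLinearMap ∘ₗ N.mkQ)
  obtain ⟨a, ha, ha0⟩ := Submodule.exists_mem_ne_zero_of_ne_bot hR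
  have h1 : a * ρ = 0 := by
    refine hC.homothety_bijective.1 ?_
    rw [map_zero, ← smul_eq_mul, map_smul, hρ]
    ext y
    exact hg a ha _
  rw [(mul_eq_zero.mp h1).resolve_left ha0, map_zero] at hρ
  obtain ⟨x, hx⟩ := N.mkQ_surjective (e.symm (Submodule.Quotient.mk 1))
  have h2 : g (e (N.mkQ x)) = 0 := (LinearMap.congr_fun hρ x).symm
  rw [hx, LinearEquiv.apply_symm_apply] at h2
  exact h0 ((one_smul R c).symm.trans h2)

section SemidualizingIdeals

variable {k : Type u} [Field k] {H : AddSubmonoid ℕ}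

/-- The properties of a semidualizing module that are used, for a fractional ideal `I` that is
normalized to satisfy `1 ∈ I ⊆ k⟦t⟧`: its endomorphism ring is `k⟦H⟧`, and every homomorphism
`I → k⸨t⸩ / I` is induced by a multiplication (as follows from `Ext¹(I, I) = 0`). -/
structure IsSemidualizingIdeal (I : Submodule (semigroupRing k H) k⸨X⸩) : Prop where
  one_mem : 1 ∈ I
  mem_laurentFil : ∀ x ∈ I, x ∈ laurentFil k 0
  mem_range_of_mul_mem : ∀ q : k⸨X⸩, (∀ x ∈ I, q * x ∈ I) →
    q ∈ (algebraMap (semigroupRing k H) k⸨X⸩).range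
  exists_mul_eq : ∀ φ : I →ₗ[semigroupRing k H] k⸨X⸩ ⧸ I,
    ∃ q : k⸨X⸩, ∀ x : I, φ x = Submodule.Quotient.mk (q * x)

variable {C : Type u} [AddCommGroup C] [Module (semigroupRing k H) C]

/-- A homomorphism from `C` to `k⸨t⸩` can be multiplied by a power of `t` to take values in
`k⟦H⟧`. -/
theorem exists_mul_eq_algebraMap {F : ℕ} (hF : ∀ n, F < n → n ∈ H)
    [Module.Finite (semigroupRing k H) C] (g : C →ₗ[semigroupRing k H] k⸨X⸩) :
    ∃ x : k⸨X⸩, x ≠ 0 ∧ ∃ h : C →ₗ[semigroupRing k H] semigroupRing k H,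
      ∀ c, algebraMap (semigroupRing k H) k⸨X⸩ (h c) = x * g c := by
  obtain ⟨N, hN⟩ := exists_forall_mem_laurentFil g
  have hex : ∀ c, ∃ r : semigroupRing k H,
      algebraMap (semigroupRing k H) k⸨X⸩ r = single ((F : ℤ) + 1 - N) 1 * g c := fun c =>
    exists_algebraMap_eq_of_mem_laurentFil hF (laurentFil_anti (by omega)
      (mul_mem_laurentFil (single_mem_laurentFil _ _) (hN c)))
  choose h hh using hex
  refine ⟨single ((F : ℤ) + 1 - N) 1, single_ne_zero one_ne_zero,
    { toFun := h
      map_add' := fun c d => algebraMap_semigroupRing_injective ?_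
      map_smul' := fun r c => algebraMap_semigroupRing_injective ?_ }, hh⟩
  · rw [map_add, hh, hh, hh, map_add, mul_add]
  · rw [RingHom.id_apply, smul_eq_mul, map_mul, hh, hh, map_smul, semigroupRing_smul_def,
      mul_left_comm]

/-- A semidualizing module has rank one: it embeds into `k⸨t⸩`. -/
theorem IsSemidualizing.exists_injective {F : ℕ} (hF : ∀ n, F < n → n ∈ H)
    (hC : IsSemidualizing (semigroupRing k H) C) :
    (∃ c : C, c ≠ 0) ∧ ∃ g : C →ₗ[semigroupRing k H] k⸨X⸩, Function.Injective g := by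
  have := hC.finite
  have hm := maximalIdeal_semigroupRing_ne_bot (k := k) hF
  have hsoc : ∀ c : C, (∀ a ∈ maximalIdeal (semigroupRing k H), a • c = 0) → c = 0 :=
    fun _ => hC.eq_zero_of_maximalIdeal_smul hm
  have htf := smul_eq_zero_of_forall_socle_eq_zero hF hsoc
  obtain ⟨c₁, hc₁⟩ : ∃ c : C, c ≠ 0 := by
    by_contra! h
    refine zero_ne_one (α := semigroupRing k H) (hC.homothety_bijective.1 ?_)
    ext c
    rw [h c, map_zero, map_zero]
  refine ⟨⟨c₁, hc₁⟩, ?_⟩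
  obtain ⟨ψ, hψ⟩ := exists_dual_apply_ne_zero (K := k⸨X⸩) (v := toGenericFibre k H C c₁)
    fun h => hc₁ ((injective_iff_map_eq_zero (toGenericFibre k H C)).mp
      (toGenericFibre_injective hF htf) c₁ h)
  set g := ψ.restrictScalars (semigroupRing k H) ∘ₗ toGenericFibre k H C with hg
  have hg₁ : g c₁ ≠ 0 := hψ
  refine ⟨g, (injective_iff_map_eq_zero g).mpr fun c₂ hc₂ => ?_⟩
  -- If `g c₂ = 0`, then `c ↦ h c • c₂`, with `h` a multiple of `g`, is not a homothety.
  obtain ⟨x, hx, h, hh⟩ := exists_mul_eq_algebraMap hF g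
  have hh₂ : h c₂ = 0 := algebraMap_semigroupRing_injective (by rw [hh, hc₂, mul_zero, map_zero])
  have hh₁ : h c₁ ≠ 0 := fun h0 => mul_ne_zero hx hg₁ (by rw [← hh, h0, map_zero])
  obtain ⟨ρ, hρ⟩ := hC.homothety_bijective.2 (LinearMap.toSpanSingleton _ _ c₂ ∘ₗ h)
  have h2 : ρ • c₂ = h c₂ • c₂ := LinearMap.congr_fun hρ c₂
  have h1 : ρ • c₁ = h c₁ • c₂ := LinearMap.congr_fun hρ c₁
  rw [hh₂, zero_smul] at h2
  rcases htf _ _ h2 with h | h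
  · rw [h, zero_smul] at h1
    exact (htf _ _ h1.symm).resolve_left hh₁
  · exact h

/-- Every semidualizing module is isomorphic to a normalized semidualizing fractional ideal. -/
theorem IsSemidualizing.exists_equiv_isSemidualizingIdeal {F : ℕ} (hF : ∀ n, F < n → n ∈ H)
    (hC : IsSemidualizing (semigroupRing k H) C) :
    ∃ I : Submodule (semigroupRing k H) k⸨X⸩, IsSemidualizingIdeal I ∧
      Nonempty (C ≃ₗ[semigroupRing k H] I) := by
  have := hC.finite
  obtain ⟨⟨c₁, hc₁⟩, g, hg⟩ := hC.exists_injective hF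
  -- Dividing by the value of smallest order normalizes the embedding.
  obtain ⟨N, hN⟩ := exists_forall_mem_laurentFil g
  obtain ⟨n, ⟨c₀, hc₀, hn⟩, hmin⟩ := Int.exists_least_of_bdd
    (P := fun n => ∃ c, c ≠ 0 ∧ (g c).order = n)
    ⟨N, by
      rintro _ ⟨c, hc, rfl⟩
      by_contra h
      exact coeff_order_eq_zero.not.mpr ((map_ne_zero_iff g hg).mpr hc) (hN c _ (not_le.mp h))⟩
    ⟨_, c₁, hc₁, rfl⟩
  have hg₀ : g c₀ ≠ 0 := (map_ne_zero_iff g hg).mpr hc₀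
  let e : C →ₗ[semigroupRing k H] k⸨X⸩ :=
    { toFun := fun c => (g c₀)⁻¹ * g c
      map_add' := fun c d => by rw [map_add, mul_add]
      map_smul' := fun r c => by
        rw [map_smul, semigroupRing_smul_def, RingHom.id_apply, semigroupRing_smul_def,
          mul_left_comm] }
  have he : ∀ c, e c = (g c₀)⁻¹ * g c := fun _ => rfl
  have he0 : e c₀ = 1 := inv_mul_cancel₀ hg₀
  have hinj : Function.Injective e := fun c d h => hg (mul_left_cancel₀ (inv_ne_zero hg₀) h)
  have hfil : ∀ c, e c ∈ laurentFil k 0 := by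
    intro c
    by_cases hc : c = 0
    · rw [hc, map_zero]; exact Submodule.zero_mem _
    · have h1 := inv_mem_laurentFil (mem_laurentFil_order (g c₀)) (coeff_order_eq_zero.not.mpr hg₀)
      refine laurentFil_anti ?_ (mul_mem_laurentFil h1 (mem_laurentFil_order (g c)))
      have := hmin _ ⟨c, hc, rfl⟩
      omega
  refine ⟨LinearMap.range e, ⟨⟨c₀, he0⟩, ?_, fun q hq => ?_, fun φ => ?_⟩,
    ⟨LinearEquiv.ofInjective e hinj⟩⟩
  · rintro _ ⟨c, rfl⟩
    exact hfil c
  · choose f hf using fun c => hq (e c) ⟨c, rfl⟩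
    obtain ⟨ρ, hρ⟩ := hC.homothety_bijective.2
      { toFun := f
        map_add' := fun c d => hinj (by rw [hf, map_add, map_add, mul_add, hf, hf])
        map_smul' := fun r c => hinj (by
          rw [hf, RingHom.id_apply, map_smul, map_smul, hf, semigroupRing_smul_def,
            semigroupRing_smul_def, mul_left_comm]) }
    refine ⟨ρ, ?_⟩
    have h1 : e (ρ • c₀) = q * e c₀ := by
      rw [← hf]
      exact congrArg e (LinearMap.congr_fun hρ c₀)
    rwa [map_smul, he0, semigroupRing_smul_def, mul_one, mul_one] at h1
  · obtain ⟨δ, hδ, -⟩ := exists_connecting_linearMap C hinj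
      (LinearMap.exact_map_mkQ_range e) (LinearMap.range e).mkQ_surjective
    have := hC.ext_eq_zero 1 one_pos
    obtain ⟨ψ, hψ⟩ := hδ (φ ∘ₗ e.rangeRestrict) (Subsingleton.elim _ _)
    have hmul : ∀ c, ψ c = ψ c₀ * e c := by
      intro c
      obtain ⟨r, hr⟩ := exists_algebraMap_eq_of_mem_laurentFil hF
        (single_mem_laurentFil (k := k) ((F : ℤ) + 1) 1)
      obtain ⟨s, hs⟩ := exists_algebraMap_eq_of_mem_laurentFil (k := k) hF
        (x := single ((F : ℤ) + 1) 1 * e c)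
        (laurentFil_anti (by omega) (mul_mem_laurentFil (single_mem_laurentFil _ _) (hfil c)))
      have h1 : r • c = s • c₀ := hinj (by
        rw [map_smul, map_smul, he0, semigroupRing_smul_def, semigroupRing_smul_def, hr, hs,
          mul_one])
      have h2 := congrArg ψ h1
      rw [map_smul, map_smul, semigroupRing_smul_def, semigroupRing_smul_def, hr, hs, mul_assoc]
        at h2
      rw [mul_left_cancel₀ (single_ne_zero one_ne_zero) h2, mul_comm]
    refine ⟨ψ c₀, ?_⟩
    rintro ⟨_, c, rfl⟩
    rw [← hmul]
    exact (LinearMap.congr_fun hψ c).symm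

end SemidualizingIdeals

/-! ### Generators of fractional ideals -/

section Generators

variable {k : Type u} [Field k] {H : AddSubmonoid ℕ} {J : Submodule (semigroupRing k H) k⸨X⸩}

theorem mem_laurentFil_succ_of_mem_smul {n : ℤ} (hJ : ∀ x ∈ J, x ∈ laurentFil k n) {x : k⸨X⸩}
    (hx : x ∈ maximalIdeal (semigroupRing k H) • J) : x ∈ laurentFil k (n + 1) := by
  induction hx using Submodule.smul_induction_on' with
  | smul a ha y hy =>
    rw [semigroupRing_smul_def, add_comm]
    exact mul_mem_laurentFil (algebraMap_mem_laurentFil_one ha) (hJ y hy)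
  | add x _ y _ hx hy => exact Submodule.add_mem _ hx hy

theorem const_smul_mem {x : k⸨X⸩} (c : k) (hx : x ∈ J) : c • x ∈ J := by
  rw [← algebraMap_smul (semigroupRing k H)]
  exact J.smul_mem _ hx

/-- Nakayama's lemma for a fractional ideal `J ⊆ k⟦t⟧` and an element `u ∈ J` of order zero: either
`u` generates `J`, or `J` has a second generator, which can be chosen of positive order. -/
theorem forall_eq_smul_or_exists_notMem {F : ℕ} (hF : ∀ n, F < n → n ∈ H)
    (hJ : ∀ x ∈ J, x ∈ laurentFil k 0) {u : k⸨X⸩} (hu : u ∈ J) (hu0 : u.coeff 0 ≠ 0) :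
    (∀ x ∈ J, ∃ r : semigroupRing k H, x = r • u) ∨
      ∃ f ∈ J, f ∈ laurentFil k 1 ∧ f ∉ maximalIdeal (semigroupRing k H) • J := by
  refine or_iff_not_imp_right.mpr fun hcon => ?_
  push Not at hcon
  have hgen : ∀ x ∈ J, ∃ c : k, x - c • u ∈ maximalIdeal (semigroupRing k H) • J := by
    intro x hx
    refine ⟨x.coeff 0 / u.coeff 0, hcon _ (J.sub_mem hx (const_smul_mem _ hu)) ?_⟩
    refine mem_laurentFil_succ (n := 0) (Submodule.sub_mem _ (hJ x hx)
      (Submodule.smul_mem _ _ (hJ u hu))) ?_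
    rw [coeff_sub, HahnSeries.coeff_smul, smul_eq_mul, div_mul_cancel₀ _ hu0, sub_self]
  have happrox : ∀ n : ℕ, ∀ x ∈ J, ∃ r : semigroupRing k H, x - r • u ∈ laurentFil k n := by
    intro n
    induction n with
    | zero => exact fun x hx => ⟨0, by rw [zero_smul, sub_zero]; exact hJ x hx⟩
    | succ n ih =>
      have ih' : ∀ z ∈ maximalIdeal (semigroupRing k H) • J,
          ∃ r : semigroupRing k H, z - r • u ∈ laurentFil k (n + 1) := by
        intro z hz
        induction hz using Submodule.smul_induction_on' with
        | smul a ha y hy =>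
          obtain ⟨r, hr⟩ := ih y hy
          refine ⟨a * r, ?_⟩
          rw [mul_smul, ← smul_sub, semigroupRing_smul_def, add_comm]
          exact mul_mem_laurentFil (algebraMap_mem_laurentFil_one ha) hr
        | add x _ y _ hx hy =>
          obtain ⟨r, hr⟩ := hx
          obtain ⟨s, hs⟩ := hy
          refine ⟨r + s, ?_⟩
          rw [add_smul, add_sub_add_comm]
          exact Submodule.add_mem _ hr hs
      intro x hx
      obtain ⟨c, hc⟩ := hgen x hx
      obtain ⟨r, hr⟩ := ih' _ hc
      refine ⟨algebraMap k _ c + r, ?_⟩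
      rw [add_smul, algebraMap_smul, ← sub_sub, Nat.cast_succ]
      exact hr
  intro x hx
  obtain ⟨r, hr⟩ := happrox (F + 1) x hx
  have h1 := mul_mem_laurentFil hr (inv_mem_laurentFil (hJ u hu) hu0)
  obtain ⟨s, hs⟩ := exists_algebraMap_eq_of_mem_laurentFil hF (laurentFil_anti (by simp) h1)
  have hu' : u ≠ 0 := by rintro rfl; exact hu0 rfl
  refine ⟨s + r, ?_⟩
  rw [add_smul, semigroupRing_smul_def s, hs, inv_mul_cancel_right₀ hu', sub_add_cancel]

theorem smul_add_smul_notMem (hJ : ∀ x ∈ J, x ∈ laurentFil k 0) {u f : k⸨X⸩}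
    (hu0 : u.coeff 0 ≠ 0) (hf1 : f ∈ laurentFil k 1)
    (hf : f ∉ maximalIdeal (semigroupRing k H) • J) {a b : k} (hab : a ≠ 0 ∨ b ≠ 0) :
    a • u + b • f ∉ maximalIdeal (semigroupRing k H) • J := by
  intro h
  have h0 := mem_laurentFil_succ_of_mem_smul hJ h 0 (by omega)
  rw [HahnSeries.coeff_add, HahnSeries.coeff_smul, HahnSeries.coeff_smul, hf1 0 (by omega),
    smul_zero, add_zero, smul_eq_mul] at h0
  have ha := (mul_eq_zero.mp h0).resolve_right hu0
  have hb : b ≠ 0 := hab.resolve_left (not_not.mpr ha)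
  rw [ha, zero_smul, zero_add] at h
  have := const_smul_mem b⁻¹ h
  rw [smul_smul, inv_mul_cancel₀ hb, one_smul] at this
  exact hf this

end Generators

/-! ### The canonical dual of a semidualizing ideal -/

section Duality

variable {k : Type u} [Field k] {H : AddSubmonoid ℕ} {I : Submodule (semigroupRing k H) k⸨X⸩}

/-- The orthogonal of a fractional ideal `I` under the pairing `(x, y) ↦ coeff F (x * y)`. It is the
canonical dual `(K : I)`, where `K` is the canonical fractional ideal. -/
def canonicalDual (F : ℕ) (I : Submodule (semigroupRing k H) k⸨X⸩) :
    Submodule (semigroupRing k H) k⸨X⸩ where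
  carrier := {g | ∀ x ∈ I, (x * g).coeff (F : ℤ) = 0}
  add_mem' hg hg' x hx := by rw [mul_add, HahnSeries.coeff_add, hg x hx, hg' x hx, add_zero]
  zero_mem' x _ := by rw [mul_zero, HahnSeries.coeff_zero]
  smul_mem' r g hg x hx := by
    have := hg _ (I.smul_mem r hx)
    rwa [semigroupRing_smul_def, mul_assoc, mul_left_comm, ← semigroupRing_smul_def] at this

theorem mul_mem_canonicalFractionalIdeal {F : ℕ} {x g : k⸨X⸩} (hx : x ∈ I)
    (hg : g ∈ canonicalDual F I) : x * g ∈ canonicalFractionalIdeal k H F := by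
  rw [mem_canonicalFractionalIdeal_iff_forall_smul]
  intro r
  have := hg _ (I.smul_mem r hx)
  rwa [semigroupRing_smul_def, mul_assoc, ← semigroupRing_smul_def] at this

namespace IsSemidualizingIdeal

variable {F : ℕ}

theorem canonicalDual_le (hI : IsSemidualizingIdeal I) {g : k⸨X⸩} (hg : g ∈ canonicalDual F I) :
    g ∈ canonicalFractionalIdeal k H F := by
  simpa using mul_mem_canonicalFractionalIdeal hI.one_mem hg

theorem mem_of_forall_coeff_mul_eq_zero (hF : ∀ n, F < n → n ∈ H) (hI : IsSemidualizingIdeal I)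
    {x : k⸨X⸩} (hx : ∀ g ∈ canonicalDual F I, (x * g).coeff (F : ℤ) = 0) : x ∈ I := by
  by_contra hxI
  obtain ⟨s, hs, hsx⟩ := exists_coeff_mul_ne_zero (F : ℤ) (W := I.restrictScalars k)
    (N := F + 1) (fun y hy => by
      obtain ⟨r, rfl⟩ := exists_algebraMap_eq_of_mem_laurentFil hF hy
      have := I.smul_mem r hI.one_mem
      rwa [semigroupRing_smul_def, mul_one] at this) hxI
  refine hsx ?_
  rw [mul_comm]
  exact hx s fun w hw => by rw [mul_comm]; exact hs w hw

/-- The canonical dual contains a power series of order zero: otherwise `t ^ F` would be an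
endomorphism of `I`. -/
theorem exists_mem_canonicalDual_coeff_zero_ne_zero (hF : ∀ n, F < n → n ∈ H) (hFH : F ∉ H)
    (hI : IsSemidualizingIdeal I) : ∃ u ∈ canonicalDual F I, u.coeff 0 ≠ 0 := by
  by_contra! h
  obtain ⟨j, hj, e⟩ := mem_range_algebraMap_iff.mp
    (hI.mem_range_of_mul_mem (single (F : ℤ) 1) fun x hx =>
      hI.mem_of_forall_coeff_mul_eq_zero hF fun g hg => by
        have h1 := coeff_mul_of_mem_laurentFil (hI.mem_laurentFil x hx)
          (canonicalFractionalIdeal_le_laurentFil hF (hI.canonicalDual_le hg))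
        rw [add_zero, h g hg, mul_zero] at h1
        rw [mul_assoc, coeff_single_mul', sub_self, h1, mul_zero]) F (by
    rw [coeff_single_same]; exact one_ne_zero)
  exact hFH (Nat.cast_injective e ▸ hj)

/-- The homomorphism `i ↦ p i • s` from `I` to `k⸨t⸩ / I` is a multiplication. -/
theorem exists_mul_sub_smul_mem (hI : IsSemidualizingIdeal I) {p : k⸨X⸩ →ₗ[k] k}
    (hp : ∀ z ∈ maximalIdeal (semigroupRing k H) • I, p z = 0) {s : k⸨X⸩}
    (hs : ∀ a ∈ maximalIdeal (semigroupRing k H), a • s ∈ I) :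
    ∃ q : k⸨X⸩, ∀ i ∈ I, q * i - p i • s ∈ I := by
  have h1 : IsScalarTower k (semigroupRing k H) I := inferInstance
  have h2 : IsScalarTower k (semigroupRing k H) (k⸨X⸩ ⧸ I) := inferInstance
  let s' : k⸨X⸩ ⧸ I := Submodule.Quotient.mk s
  have hs' : ∀ a ∈ maximalIdeal (semigroupRing k H), a • s' = 0 := fun a ha =>
    (Submodule.Quotient.mk_eq_zero I).mpr (hs a ha)
  let pI : I →ₗ[k] k := p ∘ₗ I.subtype.restrictScalars k
  have hpI : ∀ a ∈ maximalIdeal (semigroupRing k H), ∀ i : I, pI (a • i) = 0 := fun a ha i =>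
    hp _ (Submodule.smul_mem_smul ha i.2)
  obtain ⟨φ, hφ⟩ := exists_linearMap_apply_eq_smul (M := I) (N := k⸨X⸩ ⧸ I) pI hpI hs'
  obtain ⟨q, hq⟩ := hI.exists_mul_eq φ
  refine ⟨q, fun i hi => (Submodule.Quotient.eq I).mp ?_⟩
  exact (hq ⟨i, hi⟩).symm.trans (hφ ⟨i, hi⟩)

/-- If `x ∈ I` and `y` in the canonical dual `I'` are minimal generators, then `x * y ∉ 𝔪K`, as a
functional `z ↦ coeff F (q * z)` with `𝔪q ⊆ k⟦H⟧` shows. For functionals `p` on `I / 𝔪I` and `p'` on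
`I' / 𝔪I'`, the latter has the form `j ↦ coeff F (s * j)` with `𝔪s ⊆ I`, and the homomorphism
`i ↦ p i • s` from `I` to `k⸨t⸩ / I` is the multiplication by some `q`. Then
`coeff F (q * (i * j)) = p i * p' j`. -/
theorem exists_coeff_mul_mul_ne_zero (hF : ∀ n, F < n → n ∈ H) (hFH : F ∉ H)
    (hI : IsSemidualizingIdeal I) {x y : k⸨X⸩} (hx : x ∈ I)
    (hxm : x ∉ maximalIdeal (semigroupRing k H) • I) (hy : y ∈ canonicalDual F I)
    (hym : y ∉ maximalIdeal (semigroupRing k H) • canonicalDual F I) :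
    ∃ q : k⸨X⸩, (∀ a ∈ maximalIdeal (semigroupRing k H),
        a • q ∈ (algebraMap (semigroupRing k H) k⸨X⸩).range) ∧
      (q * (x * y)).coeff (F : ℤ) ≠ 0 := by
  obtain ⟨u, hu, hu0⟩ := hI.exists_mem_canonicalDual_coeff_zero_ne_zero hF hFH
  obtain ⟨p, hpx, hp⟩ := Submodule.exists_le_ker_of_notMem
    (p := (maximalIdeal (semigroupRing k H) • I).restrictScalars k) (v := x) hxm
  obtain ⟨p', hpy, hp'⟩ := Submodule.exists_le_ker_of_notMem
    (p := (maximalIdeal (semigroupRing k H) • canonicalDual F I).restrictScalars k) (v := y) hym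
  have hp0 : ∀ z ∈ maximalIdeal (semigroupRing k H) • I, p z = 0 := fun z hz => hp hz
  have hp0' : ∀ z ∈ maximalIdeal (semigroupRing k H) • canonicalDual F I, p' z = 0 :=
    fun z hz => hp' hz
  obtain ⟨s, hs⟩ := exists_coeff_mul_eq (F : ℤ) (p := p') (N := F + 1) fun z hz => hp0' z (by
    have hu' : u ≠ 0 := by rintro rfl; exact hu0 rfl
    have h1 := mul_mem_laurentFil hz (inv_mem_laurentFil (canonicalFractionalIdeal_le_laurentFil hF
      (hI.canonicalDual_le hu)) hu0)
    obtain ⟨a, ha, ha'⟩ := exists_mem_maximalIdeal_eq_of_mem_laurentFil hF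
      (laurentFil_anti (by simp) h1)
    have h2 := Submodule.smul_mem_smul ha hu
    rwa [semigroupRing_smul_def, ha', inv_mul_cancel_right₀ hu'] at h2)
  have hsI : ∀ a ∈ maximalIdeal (semigroupRing k H), a • s ∈ I := fun a ha =>
    hI.mem_of_forall_coeff_mul_eq_zero hF fun g hg => by
      rw [semigroupRing_smul_def, mul_assoc, mul_left_comm, ← semigroupRing_smul_def a g, ← hs]
      exact hp0' _ (Submodule.smul_mem_smul ha hg)
  obtain ⟨q, hqI⟩ := hI.exists_mul_sub_smul_mem hp0 hsI
  refine ⟨q, fun a ha => hI.mem_range_of_mul_mem _ fun i hi => ?_, ?_⟩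
  · have h1 := hqI _ (I.smul_mem a hi)
    have h2 : p (a • i) = 0 := hp0 _ (Submodule.smul_mem_smul ha hi)
    rw [h2, zero_smul, sub_zero] at h1
    rwa [semigroupRing_smul_def, mul_assoc, mul_left_comm, ← semigroupRing_smul_def]
  · have h1 := hy _ (hqI x hx)
    rw [sub_mul, coeff_sub, sub_eq_zero, ← HahnSeries.C_mul_eq_smul, mul_assoc, mul_assoc,
      HahnSeries.C_mul_eq_smul, HahnSeries.coeff_smul, ← hs] at h1
    rw [h1]
    exact mul_ne_zero hpx hpy

end IsSemidualizingIdeal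

end Duality

/-! ### Semidualizing ideals that are principal or have a principal dual -/

section PrincipalCases

variable {k : Type u} [Field k] {H : AddSubmonoid ℕ} {I : Submodule (semigroupRing k H) k⸨X⸩}

namespace IsSemidualizingIdeal

theorem nonempty_equiv_self (hI : IsSemidualizingIdeal I)
    (h : ∀ x ∈ I, ∃ r : semigroupRing k H, x = r • (1 : k⸨X⸩)) :
    Nonempty (I ≃ₗ[semigroupRing k H] semigroupRing k H) := by
  let φ : semigroupRing k H →ₗ[semigroupRing k H] I :=
    LinearMap.toSpanSingleton (semigroupRing k H) I ⟨1, hI.one_mem⟩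
  have hφ : ∀ r, (φ r : k⸨X⸩) = algebraMap (semigroupRing k H) k⸨X⸩ r := fun r => by
    have : (φ r : k⸨X⸩) = r • (1 : k⸨X⸩) := rfl
    rw [this, semigroupRing_smul_def, mul_one]
  refine ⟨(LinearEquiv.ofBijective φ ⟨fun r s hrs => ?_, fun x => ?_⟩).symm⟩
  · apply algebraMap_semigroupRing_injective
    rw [← hφ, ← hφ, hrs]
  · obtain ⟨r, hr⟩ := h x x.2
    refine ⟨r, Subtype.ext ?_⟩
    rw [hφ, hr, semigroupRing_smul_def, mul_one]

/-- If the canonical dual of `I` is generated by `u`, then multiplication by `u` is an isomorphism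
from `I` to the canonical ideal. -/
theorem nonempty_equiv_canonicalFractionalIdeal {F : ℕ} (hF : ∀ n, F < n → n ∈ H)
    (hI : IsSemidualizingIdeal I) {u : k⸨X⸩} (hu : u ∈ canonicalDual F I) (hu0 : u ≠ 0)
    (h : ∀ g ∈ canonicalDual F I, ∃ r : semigroupRing k H, g = r • u) :
    Nonempty (I ≃ₗ[semigroupRing k H] canonicalFractionalIdeal k H F) := by
  let φ : I →ₗ[semigroupRing k H] canonicalFractionalIdeal k H F :=
    { toFun := fun x => ⟨x * u, mul_mem_canonicalFractionalIdeal x.2 hu⟩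
      map_add' := fun x y => Subtype.ext (add_mul (x : k⸨X⸩) y u)
      map_smul' := fun r x => Subtype.ext (by
        change (r • (x : k⸨X⸩)) * u = r • ((x : k⸨X⸩) * u)
        rw [semigroupRing_smul_def, semigroupRing_smul_def, mul_assoc]) }
  refine ⟨LinearEquiv.ofBijective φ ⟨fun x y hxy => ?_, fun y => ?_⟩⟩
  · exact Subtype.ext (mul_right_cancel₀ hu0 (congrArg Subtype.val hxy))
  · have hy : (y : k⸨X⸩) * u⁻¹ * u = y := inv_mul_cancel_right₀ hu0 _
    refine ⟨⟨y * u⁻¹, hI.mem_of_forall_coeff_mul_eq_zero hF fun g hg => ?_⟩, Subtype.ext hy⟩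
    obtain ⟨r, rfl⟩ := h g hg
    rw [semigroupRing_smul_def, mul_left_comm, hy, ← semigroupRing_smul_def]
    exact (mem_canonicalFractionalIdeal_iff_forall_smul.mp y.2) r

end IsSemidualizingIdeal

/-- If `w` has order exactly `n`, an element `x` of order at least `m` with `x * w` in the canonical
ideal has no term `t ^ m`, unless the canonical ideal contains `t ^ (m + n)`. -/
theorem coeff_eq_zero_of_mul_mem_canonicalFractionalIdeal {F : ℕ} {x w : k⸨X⸩} {m n : ℤ}
    (hx : x ∈ laurentFil k m) (hw : w ∈ laurentFil k n) (hw0 : w.coeff n ≠ 0)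
    (hxw : x * w ∈ canonicalFractionalIdeal k H F) {h : ℕ} (hh : h ∈ H) (hmn : m + n = F - h) :
    x.coeff m = 0 := by
  have h1 := mem_canonicalFractionalIdeal.mp hxw h hh
  rw [← hmn, coeff_mul_of_mem_laurentFil hx hw] at h1
  exact (mul_eq_zero.mp h1).resolve_right hw0

end PrincipalCases

/-! ### The semigroup `⟨9, 19, 20, 25, 31⟩` -/

section TheSemigroup

/-- The numerical semigroup `⟨9, 19, 20, 25, 31⟩`. -/
def exampleSemigroup : AddSubmonoid ℕ := AddSubmonoid.closure ({9, 19, 20, 25, 31} : Set ℕ)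

/-- The elements of `⟨9, 19, 20, 25, 31⟩` below its conductor `43`. -/
def exampleSemigroupSmall : Finset ℕ :=
  {0, 9, 18, 19, 20, 25, 27, 28, 29, 31, 34, 36, 37, 38, 39, 40}

theorem mem_exampleSemigroup_iff {n : ℕ} :
    n ∈ exampleSemigroup ↔ n ∈ exampleSemigroupSmall ∨ 43 ≤ n := by
  constructor
  · intro hn
    induction hn using AddSubmonoid.closure_induction with
    | mem x hx =>
      left
      rcases hx with rfl | rfl | rfl | rfl | rfl <;> decide
    | zero => left; decide
    | add x y _ _ hx hy =>
      rcases hx with hx | hx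
      · rcases hy with hy | hy
        · have key : ∀ x ∈ exampleSemigroupSmall, ∀ y ∈ exampleSemigroupSmall,
              x + y ∈ exampleSemigroupSmall ∨ 43 ≤ x + y := by decide
          exact key x hx y hy
        · exact Or.inr (by omega)
      · exact Or.inr (by omega)
  · have h9 : 9 ∈ exampleSemigroup := AddSubmonoid.subset_closure (by simp)
    have h19 : 19 ∈ exampleSemigroup := AddSubmonoid.subset_closure (by simp)
    have h20 : 20 ∈ exampleSemigroup := AddSubmonoid.subset_closure (by simp)
    have h25 : 25 ∈ exampleSemigroup := AddSubmonoid.subset_closure (by simp)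
    have h31 : 31 ∈ exampleSemigroup := AddSubmonoid.subset_closure (by simp)
    have hcomb : ∀ a b c d e : ℕ, a * 9 + b * 19 + c * 20 + d * 25 + e * 31 ∈ exampleSemigroup :=
      fun a b c d e => by
        simpa only [smul_eq_mul] using add_mem (add_mem (add_mem (add_mem (nsmul_mem h9 a)
          (nsmul_mem h19 b)) (nsmul_mem h20 c)) (nsmul_mem h25 d)) (nsmul_mem h31 e)
    have hmod : ∀ m < 9, ∃ b ≤ 2, ∃ c ≤ 2, ∃ d ≤ 1, ∃ e ≤ 1,
        (b * 19 + c * 20 + d * 25 + e * 31) % 9 = m ∧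
          b * 19 + c * 20 + d * 25 + e * 31 ≤ 51 := by decide
    rintro (hn | hn)
    · have key : ∀ x ∈ exampleSemigroupSmall, ∃ a ≤ 4, ∃ b ≤ 2, ∃ c ≤ 2, ∃ d ≤ 1, ∃ e ≤ 1,
          x = a * 9 + b * 19 + c * 20 + d * 25 + e * 31 := by decide
      obtain ⟨a, -, b, -, c, -, d, -, e, -, rfl⟩ := key n hn
      exact hcomb a b c d e
    · obtain ⟨b, -, c, -, d, -, e, -, h1, h2⟩ := hmod (n % 9) (by omega)
      have : n = (n - (b * 19 + c * 20 + d * 25 + e * 31)) / 9 * 9 + b * 19 + c * 20 + d * 25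
          + e * 31 := by omega
      rw [this]
      exact hcomb _ b c d e

theorem mem_exampleSemigroup_of_lt (n : ℕ) (hn : 42 < n) : n ∈ exampleSemigroup :=
  mem_exampleSemigroup_iff.mpr (Or.inr hn)

instance : DecidablePred (· ∈ exampleSemigroup) := fun _ =>
  decidable_of_iff _ mem_exampleSemigroup_iff.symm

/-- The monomials `1, t, t ^ 7, t ^ 12` of the canonical ideal generate its monomials `t ^ n` with
`9 ≤ n`, `n ≠ 12`, over the maximal ideal. -/
theorem exists_sub_mem_exampleSemigroup {n : ℕ} (h9 : 9 ≤ n) (h12 : n ≠ 12)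
    (hn : n ≤ 42 → 42 - n ∉ exampleSemigroup) :
    ∃ e ≤ 42, 42 - e ∉ exampleSemigroup ∧ ∃ h ∈ exampleSemigroup, h ≠ 0 ∧ h + e = n := by
  by_cases h43 : n ≤ 42
  · have key : ∀ n ∈ Finset.Icc 9 42, n ≠ 12 → 42 - n ∉ exampleSemigroup →
        ∃ e ∈ ({0, 1, 7, 12} : Finset ℕ), 42 - e ∉ exampleSemigroup ∧ e < n ∧
          n - e ∈ exampleSemigroup := by decide
    obtain ⟨e, he, he', hlt, hmem⟩ := key n (Finset.mem_Icc.mpr ⟨h9, h43⟩) h12 (hn h43)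
    exact ⟨e, by omega, he', n - e, hmem, by omega, by omega⟩
  · exact ⟨0, by omega, by decide, n, mem_exampleSemigroup_of_lt n (by omega), by omega, rfl⟩

end TheSemigroup

/-! ### Semidualizing modules over `k⟦t ^ 9, t ^ 19, t ^ 20, t ^ 25, t ^ 31⟧` -/

section Example

variable {k : Type u} [Field k]

/-- If `𝔪q ⊆ R`, the functional `x ↦ coeff 42 (q * x)` on the canonical ideal `K` vanishes on `𝔪K`,
and `𝔪K` contains the elements of `K` that have order at least `9` and no term `t ^ 12`. -/
theorem coeff_mul_eq_zero_of_coeff_twelve {q x : k⸨X⸩}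
    (hq : ∀ a ∈ maximalIdeal (semigroupRing k exampleSemigroup),
      a • q ∈ (algebraMap (semigroupRing k exampleSemigroup) k⸨X⸩).range)
    (hx : x ∈ canonicalFractionalIdeal k exampleSemigroup 42) (hx9 : x ∈ laurentFil k 9)
    (hx12 : x.coeff 12 = 0) : (q * x).coeff ((42 : ℕ) : ℤ) = 0 := by
  rw [HahnSeries.coeff_mul]
  refine Finset.sum_eq_zero fun ij hij => ?_
  obtain ⟨-, hj, hij⟩ := Finset.mem_antidiagonal.mp hij
  rw [HahnSeries.mem_support] at hj
  obtain ⟨i, j⟩ := ij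
  dsimp only at hj hij ⊢
  have hj9 : 9 ≤ j := by
    by_contra h
    exact hj (hx9 j (by omega))
  lift j to ℕ using by omega
  obtain ⟨e, he, heH, h, hh, h0, rfl⟩ := exists_sub_mem_exampleSemigroup (n := j) (by omega)
    (by rintro rfl; exact hj hx12) (fun hle hmem => by
      refine hj ?_
      have := mem_canonicalFractionalIdeal.mp hx _ hmem
      rwa [Nat.cast_sub hle, sub_sub_cancel] at this)
  obtain ⟨a, ha, ha'⟩ := exists_mem_maximalIdeal_eq_single (k := k) hh h0
  by_contra hne
  obtain ⟨s, hs, e'⟩ := mem_range_algebraMap_iff.mp (hq a ha) (42 - e) (by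
    rw [semigroupRing_smul_def, ha', coeff_single_mul', one_mul,
      show (42 : ℤ) - e - h = i by push_cast at hij; omega]
    exact left_ne_zero_of_mul hne)
  exact heH ((show s = 42 - e by omega) ▸ hs)

/-- The possible orders of an element `z` with `z * w` in the canonical ideal, where `w` has order
zero. -/
theorem coeff_ne_zero_or_mem_laurentFil_nine {z w : k⸨X⸩} (hz : z ∈ laurentFil k 1)
    (hw : w ∈ laurentFil k 0) (hw0 : w.coeff 0 ≠ 0)
    (hzw : z * w ∈ canonicalFractionalIdeal k exampleSemigroup 42) :
    (∃ n : ℤ, (n = 1 ∨ n = 7) ∧ z ∈ laurentFil k n ∧ z.coeff n ≠ 0) ∨ z ∈ laurentFil k 9 := by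
  have step : ∀ h ∈ exampleSemigroup, z ∈ laurentFil k ((42 : ℕ) - h) →
      z ∈ laurentFil k ((42 : ℕ) - h + 1) := fun h hh hzh =>
    mem_laurentFil_succ hzh
      (coeff_eq_zero_of_mul_mem_canonicalFractionalIdeal hzh hw hw0 hzw hh (add_zero _))
  by_cases h1 : z.coeff 1 = 0
  · have h2 : z ∈ laurentFil k 2 := mem_laurentFil_succ hz h1
    have h3 : z ∈ laurentFil k 3 := step 40 (by decide) h2
    have h4 : z ∈ laurentFil k 4 := step 39 (by decide) h3
    have h5 : z ∈ laurentFil k 5 := step 38 (by decide) h4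
    have h6 : z ∈ laurentFil k 6 := step 37 (by decide) h5
    have h7 : z ∈ laurentFil k 7 := step 36 (by decide) h6
    by_cases h7' : z.coeff 7 = 0
    · have h8 : z ∈ laurentFil k 8 := mem_laurentFil_succ h7 h7'
      exact Or.inr (step 34 (by decide) h8)
    · exact Or.inl ⟨7, Or.inr rfl, h7, h7'⟩
  · exact Or.inl ⟨1, Or.inl rfl, hz, h1⟩

theorem exists_ne_zero_mul_add_mul_eq_zero (c d : k) :
    ∃ a b : k, (a ≠ 0 ∨ b ≠ 0) ∧ a * c + b * d = 0 := by
  by_cases hc : c = 0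
  · exact ⟨1, 0, Or.inl one_ne_zero, by rw [hc, mul_zero, zero_mul, add_zero]⟩
  · exact ⟨d, -c, Or.inr (neg_ne_zero.mpr hc), by ring⟩

/-- If neither `I` nor its canonical dual `I'` is principal, further minimal generators `f` and `g`
yield a product in `𝔪K` of minimal generators of `I` and `I'`. -/
theorem IsSemidualizingIdeal.nonempty_equiv
    {I : Submodule (semigroupRing k exampleSemigroup) k⸨X⸩} (hI : IsSemidualizingIdeal I) :
    Nonempty (I ≃ₗ[semigroupRing k exampleSemigroup] semigroupRing k exampleSemigroup) ∨
      Nonempty (I ≃ₗ[semigroupRing k exampleSemigroup]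
        canonicalFractionalIdeal k exampleSemigroup 42) := by
  have hF := mem_exampleSemigroup_of_lt
  have hFH : 42 ∉ exampleSemigroup := by decide
  obtain ⟨u, hu, hu0⟩ := hI.exists_mem_canonicalDual_coeff_zero_ne_zero hF hFH
  have hdual : ∀ g ∈ canonicalDual 42 I, g ∈ laurentFil k 0 := fun g hg =>
    canonicalFractionalIdeal_le_laurentFil hF (hI.canonicalDual_le hg)
  have h10 : (1 : k⸨X⸩).coeff 0 ≠ 0 := by rw [HahnSeries.coeff_one, if_pos rfl]; exact one_ne_zero
  rcases forall_eq_smul_or_exists_notMem hF hI.mem_laurentFil hI.one_mem h10 with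
    h | ⟨f, hfI, hf1, hfm⟩
  · exact Or.inl (hI.nonempty_equiv_self h)
  rcases forall_eq_smul_or_exists_notMem hF hdual hu hu0 with h | ⟨g, hgI, hg1, hgm⟩
  · exact Or.inr (hI.nonempty_equiv_canonicalFractionalIdeal hF hu
      (by rintro rfl; exact hu0 rfl) h)
  exfalso
  have hfgK := mul_mem_canonicalFractionalIdeal hfI hgI
  -- A product of elements of `I` and `I'` outside `𝔪I` and `𝔪I'` is detected by some `q`.
  have contra : ∀ x ∈ I, x ∉ maximalIdeal (semigroupRing k exampleSemigroup) • I →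
      ∀ y ∈ canonicalDual 42 I,
      y ∉ maximalIdeal (semigroupRing k exampleSemigroup) • canonicalDual 42 I →
      x * y ∈ laurentFil k 9 → (x * y).coeff 12 ≠ 0 := by
    intro x hx hxm y hy hym h9 h12
    obtain ⟨q, hq, hne⟩ := hI.exists_coeff_mul_mul_ne_zero hF hFH hx hxm hy hym
    exact hne (coeff_mul_eq_zero_of_coeff_twelve hq (mul_mem_canonicalFractionalIdeal hx hy)
      h9 h12)
  have hcases : f ∈ laurentFil k 9 ∨ g ∈ laurentFil k 9 := by
    have hu' := mul_mem_canonicalFractionalIdeal hfI hu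
    have hg' := mul_mem_canonicalFractionalIdeal hI.one_mem hgI
    rw [mul_comm] at hg'
    rcases coeff_ne_zero_or_mem_laurentFil_nine hf1 (hdual u hu) hu0 hu' with
      ⟨m, hm, hfm, hfm0⟩ | h
    · rcases coeff_ne_zero_or_mem_laurentFil_nine hg1 (hI.mem_laurentFil 1 hI.one_mem) h10 hg' with
        ⟨n, hn, hgn, hgn0⟩ | h
      · -- The canonical ideal has no elements of order `2`, `8` or `14`.
        exfalso
        have key : ∀ h ∈ exampleSemigroup, m + n ≠ (42 : ℕ) - h := fun h hh e =>
          hfm0 (coeff_eq_zero_of_mul_mem_canonicalFractionalIdeal hfm hgn hgn0 hfgK hh e)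
        rcases hm with rfl | rfl <;> rcases hn with rfl | rfl
        · exact key 40 (by decide) (by norm_num)
        · exact key 34 (by decide) (by norm_num)
        · exact key 34 (by decide) (by norm_num)
        · exact key 28 (by decide) (by norm_num)
      · exact Or.inr h
    · exact Or.inl h
  rcases hcases with hf9 | hg9
  · obtain ⟨a, b, hab, h0⟩ := exists_ne_zero_mul_add_mul_eq_zero ((f * u).coeff 12)
      ((f * g).coeff 12)
    have e : f * (a • u + b • g) = a • (f * u) + b • (f * g) := by
      simp only [← HahnSeries.C_mul_eq_smul]
      ring
    refine contra f hfI hfm (a • u + b • g)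
      (Submodule.add_mem _ (const_smul_mem a hu) (const_smul_mem b hgI))
      (smul_add_smul_notMem hdual hu0 hg1 hgm hab) ?_ ?_
    · rw [← add_zero (9 : ℤ)]
      exact mul_mem_laurentFil hf9 (Submodule.add_mem _ (Submodule.smul_mem _ a (hdual u hu))
        (Submodule.smul_mem _ b (hdual g hgI)))
    · rw [e, HahnSeries.coeff_add, HahnSeries.coeff_smul, HahnSeries.coeff_smul, smul_eq_mul,
        smul_eq_mul, h0]
  · obtain ⟨a, b, hab, h0⟩ := exists_ne_zero_mul_add_mul_eq_zero (g.coeff 12)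
      ((f * g).coeff 12)
    have e : (a • 1 + b • f) * g = a • g + b • (f * g) := by
      simp only [← HahnSeries.C_mul_eq_smul]
      ring
    refine contra (a • 1 + b • f)
      (Submodule.add_mem _ (const_smul_mem a hI.one_mem) (const_smul_mem b hfI))
      (smul_add_smul_notMem hI.mem_laurentFil h10 hf1 hfm hab) g hgI hgm ?_ ?_
    · rw [← zero_add (9 : ℤ)]
      exact mul_mem_laurentFil (Submodule.add_mem _
        (Submodule.smul_mem _ a (hI.mem_laurentFil 1 hI.one_mem))
        (Submodule.smul_mem _ b (hI.mem_laurentFil f hfI))) hg9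
    · rw [e, HahnSeries.coeff_add, HahnSeries.coeff_smul, HahnSeries.coeff_smul, smul_eq_mul,
        smul_eq_mul, h0]

end Example

theorem proposition4p4 (k : Type u) [Field k] :
    HasOnlyTrivialSemidualizingModules
      (semigroupRing k (AddSubmonoid.closure ({9, 19, 20, 25, 31} : Set ℕ))) := by
  change HasOnlyTrivialSemidualizingModules (semigroupRing k exampleSemigroup)
  have hF := mem_exampleSemigroup_of_lt
  refine ⟨⟨canonicalFractionalIdeal k exampleSemigroup 42, _, _,
    isCanonicalModule_canonicalFractionalIdeal hF⟩, ?_⟩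
  intro K _ _ hK C _ _ hC
  obtain ⟨I, hI, ⟨e⟩⟩ := hC.exists_equiv_isSemidualizingIdeal hF
  obtain ⟨e'⟩ := nonempty_equiv_canonicalFractionalIdeal hF hK
  rcases hI.nonempty_equiv with ⟨⟨e₁⟩⟩ | ⟨⟨e₁⟩⟩
  · exact Or.inl ⟨e.trans e₁⟩
  · exact Or.inr ⟨(e.trans e₁).trans e'.symm⟩
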